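/- **Setting.** Let $X\subseteq\mathbb R^n$ be Borel, $U$ a finite nonempty set, $W\subset\mathbb R^d$ compact, and $x_{t+1}=f(x_t,u_t,w_t)$ with $f:X\times U\times W\to X$ and $w_t$ i.i.d. with law $P_W$ on $W$. Let $\mathcal T(\cdot\mid x,u)$ be the law of $f(x,u,w)$, $w\sim P_W$. Let $X_{\rm safe}\subseteq X$, let $r_1,\dots,r_{m+1}$ be Borel, pairwise disjoint sets (regions) covering $X$ with $r_{m+1}=X\setminus X_{\rm safe}$, and let $L:X\to 2^{\rm AP}$ be a labeling (AP finite) that is constant on each region, with $\mathfrak p_{\rm safe}\in L(x)$ iff $x\in X_{\rm safe}$. Assume: (1) $X_{\rm safe}$ is compact and the boundary in $X$ of every region is Lebesgue-null; (2) every $\mathcal T(\cdot\mid x,u)$ has a Lebesgue density $\tau(\cdot\mid x,u)$, and $\tau$ is bounded uniformly in $x,u$; (3) $\|f(x,u,w)-f(x',u,w')\|\le L_f(\|x-x'\|+\|w-w'\|)$ for some $L_f\ge0$. A controller $\kappa=(\kappa_t)$ consists of measurable maps from trajectories $x_0u_0\dots x_t$ to $U$. A trajectory satisfies a formula of linear temporal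 logic over finite traces (LTL$_f$) if some nonempty prefix of its trace $L(x_0)L(x_1)\dots$ does. $\Pr^\kappa_{x_0}[\varphi,T]$ is the probability that the trajectory $x_0\dots x_T$ under $\kappa$ satisfies $\varphi$, and $\Pr^*_{x_0}[\varphi,T]=\sup_\kappa\Pr^\kappa_{x_0}[\varphi,T]$. Specifications are $\varphi=\square\mathfrak p_{\rm safe}\wedge\varphi'$ with $\varphi'$ any LTL$_f$ formula over AP. **Abstraction.** Let $X_{\rm abs}=X_{\rm safe}\cup f(X_{\rm safe},U,W)$. For every $\eta>0$ let $B^\eta$ be a finite partition of $X_{\rm abs}$ into Borel cells, each contained in or disjoint from each region, with a representative point chosen in each cell; let $S^\eta$ be the set of representatives, $\rho$ the map sending a point to the representative of its cell, and $\mathrm{cell}(s)$ the cell of $s$; let $C^\eta$ be a finite Borel partition of $W$; all elements of $B^\eta$ and $C^\eta$ have diameter at most $2\eta$. For $s\in S^\eta\cap X_{\rm safe}$, $a\in U$, $c\in C^\eta$ put $$\mathcal R(s,a,c)=\{f(x,a,w):x\in\mathrm{cell}(s),\,w\in c\},\qquad q_{s,a,c}=\{s'\in S^\eta:\mathrm{cell}(s')\cap\mathcal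 R(s,a,c)\ne\emptyset\}.$$ The SMDP abstraction has state set $S^\eta$, actions $U$ and ambiguity sets $$\Gamma^\eta_{s,a}=\Big\{\sum_{c\in C^\eta}P_W(c)\,\theta_c:\ \theta_c\text{ a probability distribution on }q_{s,a,c}\Big\}\ (s\in X_{\rm safe}),\qquad \Gamma^\eta_{s,a}=\{\delta_s\}\ (s\notin X_{\rm safe}).$$ Its ambiguity diameter $\phi(\eta)$ is the maximum over $s\in S^\eta\cap X_{\rm safe}$ and $a\in U$ of the diameter of $\Gamma^\eta_{s,a}$ in the 1-Wasserstein distance ($0$ if there is no such $s$). **Robust dynamic programming (RDP).** Let $\mathcal A$ be a finite deterministic automaton over $2^{\rm AP}$ with states $Z$, initial state $z_{\rm init}$, transition function $\delta$ and accepting set $Z_{\rm acc}$, accepting exactly the nonempty finite traces satisfying $\varphi$. For $v:X\times Z\to[0,1]$ let $v^\eta(x,z)$ be the infimum of $v(\cdot,z)$ over the cell containing $x$ (and $0$ if $x\notin X_{\rm abs}$). Put $\underline{\mathcal B}_a[v](x,z)=1$ if $z\in Z_{\rm acc}$ and otherwise $\underline{\mathcal B}_a[v](x,z)=\min_{\gamma\in\Gamma^\eta_{\rho(x),a}}\sum_{s'}\gamma(s')\,v^\eta(s',\delta(z,L(s')))$;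 $\overline{\mathcal B}_a$ is the same with $\max$. Let $\underline v_0=\overline v_0=\mathbb 1_{X\times Z_{\rm acc}}$, and let $\underline v_{k+1}=\max_a\underline{\mathcal B}_a[\underline v_k]$, $\overline v_{k+1}=\max_a\overline{\mathcal B}_a[\overline v_k]$ for $x\in X_{\rm safe}$, both being $0$ for $x\notin X_{\rm safe}$. Set $\underline p^\eta(x)=\underline v_T(x,\delta(z_{\rm init},L(x)))$ and $\overline p^\eta(x)=\overline v_T(x,\delta(z_{\rm init},L(x)))$. A strategy with $\sigma_t(s,z)\in\arg\max_a\underline{\mathcal B}_a[\underline v_{T-t-1}](s,z)$ (ties broken arbitrarily) gives the controller $\kappa^\eta$ that at time $t$ plays $\sigma_t(\rho(x_t),z_t)$ if $x_t\in X_{\rm abs}$ (and a fixed action otherwise), where $z_t$ is the state of $\mathcal A$ after reading $L(x_0)\dots L(x_t)$. **Theorem.** For any choice of the partitions and representatives as above: 1. For every $\eta>0$ the sets $\Gamma^\eta_{s,a}$ are nonempty, closed sets of probability distributions on $S^\eta$, and the abstraction is sound: $\big(\mathcal T(\mathrm{cell}(s')\mid x,a)\big)_{s'\in S^\eta}\in\Gamma^\eta_{\rho(x),a}$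 for all $x\in X_{\rm safe}$ and $a\in U$, and $\Gamma^\eta_{\rho(x),a}=\{\delta_{\rho(x)}\}$ for $x\in X_{\rm abs}\setminus X_{\rm safe}$. 2. $\phi(\eta)\le(4L_f+4)\eta$ for all $\eta>0$; if every representative is within distance $\eta$ of all points of its cell, then $\phi(\eta)\le(4L_f+2)\eta$. In particular $\lim_{\eta\to0}\phi(\eta)=0$. 3. The procedure is asymptotically optimal: for every $\varphi'$, $T\in\mathbb N_0$, every such automaton and all RDP strategies, $\Pr^{\kappa^\eta}_{x}[\varphi,T]$, $\underline p^\eta(x)$ and $\overline p^\eta(x)$ converge to $\Pr^*_{x}[\varphi,T]$ as $\eta\to0$, uniformly in $x\in X$. 4. The abstraction-refinement algorithm is complete. Let $\varphi'$, $T\in\mathbb N_0$, $\varepsilon>0$ and a positive sequence $\eta_i$ strictly decreasing to $0$ be given. An automaton $\mathcal A$ as above exists, and for every such $\mathcal A$ the algorithm which for $i=1,2,\dots$ builds the abstraction with parameter $\eta_i$ and runs RDP on it, until $\overline p(x)-\underline p(x)\le\varepsilon$ for all $x\in X$, halts after finitely many iterations. Its output $(\kappa,\underline p,\overline p)$ consists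 of a controller and bounds with $|\Pr^\kappa_{x_0}[\varphi,T]-\Pr^*_{x_0}[\varphi,T]|\le\varepsilon$, $\underline p(x_0)\le\Pr^\kappa_{x_0}[\varphi,T]\le\overline p(x_0)$ and $\overline p(x_0)-\underline p(x_0)\le\varepsilon$ for all $x_0\in X$. -/

import Mathlib

open Set Filter Topology MeasureTheory
open scoped ENNReal Classical

noncomputable section

/-! ### Linear temporal logic over finite traces -/

/-- Formulas of linear temporal logic over finite traces. -/
inductive LTLf (AP : Type) : Type where
  | top : LTLf AP
  | atom (p : AP) : LTLf AP
  | neg (φ : LTLf AP) : LTLf AP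
  | conj (φ ψ : LTLf AP) : LTLf AP
  | next (φ : LTLf AP) : LTLf AP
  | untl (φ ψ : LTLf AP) : LTLf AP

namespace LTLf

variable {AP : Type}

/-- `φ.Sat l`: the finite trace `l = l₀ l₁ … l_T` satisfies `φ` (at its first position).
The positions of a trace are represented by its nonempty suffixes; `next` is the strong next. -/
def Sat : LTLf AP → List (Set AP) → Prop
  | top, _ => True
  | atom p, l => ∃ a ∈ l.head?, p ∈ a
  | neg φ, l => ¬ Sat φ l
  | conj φ ψ, l => Sat φ l ∧ Sat ψ l
  | next φ, l => 1 < l.length ∧ Sat φ l.tail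
  | untl φ ψ, l => ∃ j < l.length, Sat ψ (l.drop j) ∧ ∀ i < j, Sat φ (l.drop i)

/-- `◇ φ = ⊤ U φ`. -/
def eventually (φ : LTLf AP) : LTLf AP := untl top φ

/-- `□ φ = ¬ ◇ ¬ φ`. -/
def always (φ : LTLf AP) : LTLf AP := neg (eventually (neg φ))

/-- The deterministic automaton `A` over the alphabet `2^AP` accepts exactly the (nonempty) finite
traces that satisfy `φ`. -/
def RecognizedBy (φ : LTLf AP) {Z : Type} (A : DFA (Set AP) Z) : Prop :=
  ∀ l : List (Set AP), l ≠ [] → (A.eval l ∈ A.accept ↔ φ.Sat l)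

end LTLf

/-! ### Wasserstein distance -/

/-- The (first) Wasserstein distance: infimum over all couplings of the expected distance. -/
def wasserstein {α : Type} [PseudoEMetricSpace α] [MeasurableSpace α] (μ ν : Measure α) : ℝ≥0∞ :=
  ⨅ π ∈ {π : Measure (α × α) | π.map Prod.fst = μ ∧ π.map Prod.snd = ν},
    ∫⁻ p, edist p.1 p.2 ∂π

/-! ### Stochastic systems -/

/-- A discrete-time stochastic system `x_{t+1} = f (x_t, u_t, w_t)` on `X ⊆ ℝⁿ` with i.i.d.
disturbances `w_t ∼ P_W` in a compact set `W ⊂ ℝᵈ`, regions of interest partitioning `X` the last of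
which is the complement of the safe set, and a labeling that is constant on every region.
Topological and measure-theoretic notions on `X` and `W` are those of the subspaces. -/
structure StochSystem (n d : ℕ) (U AP : Type) where
  X : Set (EuclideanSpace ℝ (Fin n))
  measurableSet_X : MeasurableSet X
  W : Set (EuclideanSpace ℝ (Fin d))
  isCompact_W : IsCompact W
  f : X → U → W → X
  PW : Measure W
  isProb : IsProbabilityMeasure PW
  safe : Set X
  /-- the regions of interest `r_1, …, r_{m+1}` -/
  m : ℕ
  region : Fin (m + 1) → Set X
  measurableSet_region : ∀ i, MeasurableSet (region i)
  region_disjoint : Pairwise fun i j => Disjoint (region i) (region j)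
  region_cover : ⋃ i, region i = univ
  region_last : region (Fin.last m) = safeᶜ
  L : X → Set AP
  L_const : ∀ i, ∀ x ∈ region i, ∀ y ∈ region i, L x = L y
  pSafe : AP
  pSafe_mem : ∀ x, pSafe ∈ L x ↔ x ∈ safe

attribute [instance] StochSystem.isProb

namespace StochSystem

variable {n d : ℕ} {U AP : Type} (S : StochSystem n d U AP)

/-- The transition kernel `T(· ∣ x, u)`: the law of `f (x, u, w)` for `w ∼ P_W`. -/
def trans (x : S.X) (u : U) : Measure S.X := S.PW.map (S.f x u)

/-- Lebesgue measure on the subset `X` of `ℝⁿ`. -/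
def lebesgue : Measure S.X := Measure.comap Subtype.val volume

/-- The safe set is compact and the boundary of every region has Lebesgue measure zero. -/
def CompactSafeNullBoundary : Prop :=
  IsCompact S.safe ∧ ∀ i, S.lebesgue (frontier (S.region i)) = 0

/-- Every `T(· ∣ x, u)` has a density `τ(· ∣ x, u)` w.r.t. Lebesgue measure, and `τ` is bounded. -/
def BoundedDensity : Prop :=
  ∃ (τ : S.X → U → S.X → ℝ≥0∞) (τmax : ℝ≥0∞), τmax < ∞ ∧
    (∀ x u, Measurable (τ x u)) ∧ (∀ x u x', τ x u x' ≤ τmax) ∧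
    ∀ x u, S.trans x u = S.lebesgue.withDensity (τ x u)

/-- `f` is `L_f`-Lipschitz in the state and the disturbance. -/
def LipschitzDynamics (Lf : ℝ) : Prop :=
  0 ≤ Lf ∧ ∀ x x' u w w', dist (S.f x u w) (S.f x' u w') ≤ Lf * (dist x x' + dist w w')

/-! #### Trajectories, controllers and satisfaction probabilities -/

/-- Trajectories `x₀ →(u₀) … →(u_{t-1}) x_t` of length `t`. -/
abbrev Traj (t : ℕ) : Type := (Fin (t + 1) → S.X) × (Fin t → U)

/-- A family of functions `κ_t` mapping trajectories of length `t` to actions. For the horizon `T`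
only `κ_0, …, κ_{T-1}` matter. -/
abbrev Policy : Type := ∀ t : ℕ, S.Traj t → U

/-- Controllers are the policies for which the trajectory measure makes sense. -/
def IsController [MeasurableSpace U] (κ : S.Policy) : Prop := ∀ t, Measurable (κ t)

/-- The trajectory up to time `t` under `κ` from `x₀`, for the disturbance realization `w`. -/
def traj (κ : S.Policy) (x₀ : S.X) (w : ℕ → S.W) : ∀ t : ℕ, S.Traj t
  | 0 => (fun _ => x₀, Fin.elim0)
  | t + 1 =>
    let ω := traj κ x₀ w t
    let u := κ t ω
    (Fin.snoc (α := fun _ => S.X) ω.1 (S.f (ω.1 (Fin.last t)) u (w t)),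
      Fin.snoc (α := fun _ => U) ω.2 u)

/-- The law `Pr_{x₀}^κ` of the trajectory of length `T`, the disturbances being i.i.d. `∼ P_W`. -/
def trajMeasure [MeasurableSpace U] (κ : S.Policy) (x₀ : S.X) (T : ℕ) : Measure (S.Traj T) :=
  (Measure.infinitePi fun _ : ℕ => S.PW).map fun w => S.traj κ x₀ w T

/-- The observation trace `L(x₀) … L(x_T)` of a trajectory. -/
def trace {t : ℕ} (ω : S.Traj t) : List (Set AP) := List.ofFn fun i => S.L (ω.1 i)

/-- A trajectory satisfies `φ` if some (nonempty) prefix of its trace does. -/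
def TrajSat {t : ℕ} (ω : S.Traj t) (φ : LTLf AP) : Prop :=
  ∃ l, l <+: S.trace ω ∧ l ≠ [] ∧ φ.Sat l

/-- `Pr_{x₀}^κ[φ, T]`. -/
def prob [MeasurableSpace U] (κ : S.Policy) (x₀ : S.X) (φ : LTLf AP) (T : ℕ) : ℝ :=
  (S.trajMeasure κ x₀ T).real {ω | S.TrajSat ω φ}

/-- `Pr_{x₀}^*[φ, T]`, the supremum over all controllers. -/
def optProb [MeasurableSpace U] (x₀ : S.X) (φ : LTLf AP) (T : ℕ) : ℝ :=
  ⨆ κ : {κ : S.Policy // S.IsController κ}, S.prob κ.1 x₀ φ T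

/-- The specification `□ p_safe ∧ φ'`. -/
def spec (φ' : LTLf AP) : LTLf AP := LTLf.conj (LTLf.always (LTLf.atom S.pSafe)) φ'

/-- The controller `κ` with the bounds `pl, pu` solves the near-optimal control problem. -/
def Solves [MeasurableSpace U] (φ : LTLf AP) (T : ℕ) (ε : ℝ) (κ : S.Policy) (pl pu : S.X → ℝ) :
    Prop :=
  S.IsController κ ∧ ∀ x₀ : S.X,
    |S.prob κ x₀ φ T - S.optProb x₀ φ T| ≤ ε ∧
    S.prob κ x₀ φ T ∈ Icc (pl x₀) (pu x₀) ∧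
    pu x₀ - pl x₀ ≤ ε

/-! #### Discretizations and UMDP abstractions -/

/-- `X_abs`: the safe set together with all one-step successors of safe states. -/
def absSet : Set S.X := S.safe ∪ {y | ∃ x ∈ S.safe, ∃ u w, y = S.f x u w}

/-- One-step reachable set of `b ⊆ X` and `c ⊆ W` under the action `a`. -/
def reach (b : Set S.X) (a : U) (c : Set S.W) : Set S.X :=
  {y | ∃ x ∈ b, ∃ w ∈ c, y = S.f x a w}

/-- A finite region-respecting partition of `X_abs` with representative points, and a finite
partition of `W`. The former is given by the set `reps` of representative points and the refinement
function `rho` that sends a point of `X_abs` to the representative of its cell; the cells are the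
fibres of `rho` in `X_abs` (the values of `rho` outside `X_abs` play no role). -/
structure Discretization where
  reps : Finset S.X
  rho : S.X → S.X
  reps_subset : ∀ s ∈ reps, s ∈ S.absSet
  rho_mem : ∀ x ∈ S.absSet, rho x ∈ reps
  rho_reps : ∀ s ∈ reps, rho s = s
  measurableSet_cell : ∀ s ∈ reps, MeasurableSet {x ∈ S.absSet | rho x = s}
  respects : ∀ s ∈ reps, ∀ i, {x ∈ S.absSet | rho x = s} ⊆ S.region i ∨
    {x ∈ S.absSet | rho x = s} ⊆ (S.region i)ᶜ
  C : Finset (Set S.W)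
  C_partition : Setoid.IsPartition (C : Set (Set S.W))
  measurableSet_C : ∀ c ∈ C, MeasurableSet c

variable {S}

/-- The cell with representative `s`. -/
def Discretization.cell (D : Discretization S) (s : S.X) : Set S.X := {x ∈ S.absSet | D.rho x = s}

/-- The size parameter of both partitions is at most `η`, i.e. all diameters are at most `2 η`. -/
def Discretization.SizeLE (D : Discretization S) (η : ℝ) : Prop :=
  (∀ s ∈ D.reps, ∀ x ∈ D.cell s, ∀ y ∈ D.cell s, dist x y ≤ 2 * η) ∧
  ∀ c ∈ D.C, ∀ w ∈ c, ∀ w' ∈ c, dist w w' ≤ 2 * η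

/-- The representative point of every cell is within `η` of all points of the cell. -/
def Discretization.Centered (D : Discretization S) (η : ℝ) : Prop :=
  ∀ s ∈ D.reps, ∀ x ∈ D.cell s, dist x s ≤ η

variable (S) in
/-- An uncertain MDP over the representative points: an ambiguity set `Γ s a` of weight functions
on `reps` for every representative `s` (values of `Γ` at other points play no role) and action
`a`; its labeling is the restriction of the labeling of the system. -/
structure UMDP extends Discretization S where
  Γ : S.X → U → Set (reps → ℝ)

namespace UMDP

variable (M : UMDP S)

/-- The ambiguity sets are nonempty closed sets of probability distributions on the states. -/
def WellFormed : Prop :=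
  ∀ s ∈ M.reps, ∀ a, (M.Γ s a).Nonempty ∧ IsClosed (M.Γ s a) ∧ M.Γ s a ⊆ stdSimplex ℝ M.reps

/-- The point mass at `s` as a weight function on the representative points. -/
def pointMass (D : Discretization S) (s : S.X) : D.reps → ℝ :=
  fun s' => if (s' : S.X) = s then 1 else 0

/-- A weight function on the representative points as a measure on `X`. -/
def toMeasure (D : Discretization S) (γ : D.reps → ℝ) : Measure S.X :=
  ∑ s : D.reps, ENNReal.ofReal (γ s) • Measure.dirac (s : S.X)

/-- Soundness: the discretized kernel `s' ↦ T(cell s' ∣ x, a)` belongs to the ambiguity set of the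
representative of `x` for safe `x`, and states outside the safe set are absorbing. -/
def Sound : Prop :=
  (∀ x ∈ S.safe, ∀ a, (fun s' : M.reps => (S.trans x a).real (M.cell s')) ∈ M.Γ (M.rho x) a) ∧
  ∀ x ∈ S.absSet, x ∉ S.safe → ∀ a, M.Γ (M.rho x) a = {pointMass M.toDiscretization (M.rho x)}

/-- The ambiguity diameter `φ(M)`: the largest Wasserstein diameter of the ambiguity sets of the
safe states. -/
def ambiguityDiameter : ℝ≥0∞ :=
  ⨆ s ∈ {s | s ∈ M.reps ∧ s ∈ S.safe}, ⨆ a, ⨆ γ ∈ M.Γ s a, ⨆ γ' ∈ M.Γ s a,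
    wasserstein (toMeasure M.toDiscretization γ) (toMeasure M.toDiscretization γ')

/-! #### Robust dynamic programming on the product with an automaton -/

variable {Z : Type} (A : DFA (Set AP) Z)

/-- The tightest minorant of `v` that is constant on the cells; zero outside `X_abs`. -/
def minorant (v : S.X → Z → ℝ) (x : S.X) (z : Z) : ℝ :=
  if x ∈ S.absSet then sInf ((fun y => v y z) '' {y ∈ S.absSet | M.rho y = M.rho x}) else 0

/-- The integral of `v^η(·, δ(z, L(·)))` w.r.t. the weights `γ`. -/
def expect (v : S.X → Z → ℝ) (z : Z) (γ : M.reps → ℝ) : ℝ :=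
  ∑ s' : M.reps, γ s' * M.minorant v s' (A.step z (S.L s'))

/-- The pessimistic Bellman operator for the action `a`. -/
def bellmanLow (a : U) (v : S.X → Z → ℝ) (x : S.X) (z : Z) : ℝ :=
  if z ∈ A.accept then 1 else sInf (M.expect A v z '' M.Γ (M.rho x) a)

/-- The optimistic Bellman operator for the action `a`. -/
def bellmanUp (a : U) (v : S.X → Z → ℝ) (x : S.X) (z : Z) : ℝ :=
  if z ∈ A.accept then 1 else sSup (M.expect A v z '' M.Γ (M.rho x) a)

/-- The pessimistic value functions. -/
def vLow : ℕ → S.X → Z → ℝ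
  | 0 => fun _ z => if z ∈ A.accept then 1 else 0
  | k + 1 => fun x z => if x ∈ S.safe then ⨆ a, M.bellmanLow A a (vLow k) x z else 0

/-- The optimistic value functions. -/
def vUp : ℕ → S.X → Z → ℝ
  | 0 => fun _ z => if z ∈ A.accept then 1 else 0
  | k + 1 => fun x z => if x ∈ S.safe then ⨆ a, M.bellmanUp A a (vUp k) x z else 0

/-- The lower bound computed by robust dynamic programming. -/
def pLow (T : ℕ) (x : S.X) : ℝ := M.vLow A T x (A.step A.start (S.L x))

/-- The upper bound computed by robust dynamic programming. -/
def pUp (T : ℕ) (x : S.X) : ℝ := M.vUp A T x (A.step A.start (S.L x))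

/-- Markovian strategies of the product: time, state of the abstraction, state of the automaton. -/
abbrev Strategy (U : Type) {n d : ℕ} {AP : Type} (S : StochSystem n d U AP) (Z : Type) : Type :=
  ℕ → S.X → Z → U

/-- `σ` is a strategy computed by robust dynamic programming: it picks maximizers of the
pessimistic Bellman operator (ties are broken arbitrarily). -/
def IsRDPStrategy (T : ℕ) (σ : Strategy U S Z) : Prop :=
  ∀ t < T, ∀ s ∈ M.reps, ∀ z a,
    M.bellmanLow A a (M.vLow A (T - t - 1)) s z ≤
      M.bellmanLow A (σ t s z) (M.vLow A (T - t - 1)) s z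

/-- The policy of the system obtained from a strategy `σ` of the product: it tracks the
representative of the current state and the state of the automaton. Outside `X_abs`, where there is
no representative, an arbitrary fixed action is used. -/
def refine [Nonempty U] (σ : Strategy U S Z) : S.Policy := fun t ω =>
  if ω.1 (Fin.last t) ∈ S.absSet then
    σ t (M.rho (ω.1 (Fin.last t))) (A.eval (S.trace ω))
  else Classical.arbitrary U

end UMDP

/-! #### Abstraction procedures, asymptotic optimality and the refinement algorithm -/

/-- `abs` soundly abstracts the system into a UMDP with partitions of size at most `η`, for every
`η > 0`. -/
def IsAbstractionProcedure (abs : ℝ → UMDP S) : Prop :=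
  ∀ η > 0, (abs η).SizeLE η ∧ (abs η).WellFormed ∧ (abs η).Sound

/-- For every specification and every horizon, the performance of the controllers and both bounds
computed by robust dynamic programming converge uniformly on `X` to the optimal probability. -/
def AsymptoticallyOptimal [MeasurableSpace U] [Nonempty U] (abs : ℝ → UMDP S) : Prop :=
  ∀ (φ' : LTLf AP) (T : ℕ) (Z : Type) [Finite Z] (A : DFA (Set AP) Z),
    (S.spec φ').RecognizedBy A →
    ∀ σ : ℝ → UMDP.Strategy U S Z, (∀ η > 0, (abs η).IsRDPStrategy A T (σ η)) →
      TendstoUniformly (fun η x => S.prob ((abs η).refine A (σ η)) x (S.spec φ') T)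
        (fun x => S.optProb x (S.spec φ') T) (𝓝[>] 0) ∧
      TendstoUniformly (fun η x => (abs η).pLow A T x)
        (fun x => S.optProb x (S.spec φ') T) (𝓝[>] 0) ∧
      TendstoUniformly (fun η x => (abs η).pUp A T x)
        (fun x => S.optProb x (S.spec φ') T) (𝓝[>] 0)

/-- The data computed in the body of the loop of the refinement algorithm. -/
structure RDPResult (S : StochSystem n d U AP) (Z : Type) where
  umdp : UMDP S
  lower : S.X → ℝ
  upper : S.X → ℝ
  strat : UMDP.Strategy U S Z

/-- The state of the refinement algorithm: the loop counter and the data of the last iteration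
(`none` before the first one). -/
structure AlgState (S : StochSystem n d U AP) (Z : Type) where
  iter : ℕ
  cur : Option (RDPResult S Z)

/-- The guard of the while loop: the largest gap between the bounds exceeds `ε`, or nothing has been
computed yet. -/
def AlgState.Continue {Z : Type} (ε : ℝ) (q : AlgState S Z) : Prop :=
  ∀ r ∈ q.cur, ∃ x, ε < r.upper x - r.lower x

/-- One pass through the while loop: if the guard holds, increase the counter `i`, abstract the
system with parameter `η_i`, and run robust dynamic programming; `pick i` is the strategy that it
returns. If the guard fails, the algorithm has halted. -/
def algStep {Z : Type} (abs : ℝ → UMDP S) (η : ℕ → ℝ) (A : DFA (Set AP) Z) (T : ℕ) (ε : ℝ)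
    (pick : ℕ → UMDP.Strategy U S Z) (q : AlgState S Z) : AlgState S Z :=
  if q.Continue ε then
    { iter := q.iter + 1
      cur := some
        { umdp := abs (η (q.iter + 1))
          lower := (abs (η (q.iter + 1))).pLow A T
          upper := (abs (η (q.iter + 1))).pUp A T
          strat := pick (q.iter + 1) } }
  else q

/-- The state of the algorithm after `k` passes. -/
def algRun {Z : Type} (abs : ℝ → UMDP S) (η : ℕ → ℝ) (A : DFA (Set AP) Z) (T : ℕ) (ε : ℝ)
    (pick : ℕ → UMDP.Strategy U S Z) (k : ℕ) : AlgState S Z :=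
  (algStep abs η A T ε pick)^[k] { iter := 0, cur := none }

/-- For every specification, horizon and `ε > 0`, an automaton for the specification exists, and,
for every such automaton, every positive sequence strictly decreasing to `0` and every tie-breaking
in the dynamic programs, the algorithm halts after finitely many passes through its loop and its
output (the refined strategy and the two bounds) solves the near-optimal control problem. -/
def AlgorithmSolvesInFiniteTime [MeasurableSpace U] [Nonempty U] (abs : ℝ → UMDP S) : Prop :=
  ∀ (φ' : LTLf AP) (T : ℕ) (ε : ℝ), 0 < ε →
    (∃ (Z : Type) (_ : Finite Z) (A : DFA (Set AP) Z), (S.spec φ').RecognizedBy A) ∧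
    ∀ (Z : Type) [Finite Z] (A : DFA (Set AP) Z), (S.spec φ').RecognizedBy A →
    ∀ η : ℕ → ℝ, (∀ i, 0 < η i) → StrictAnti η → Tendsto η atTop (𝓝 0) →
    ∀ pick : ℕ → UMDP.Strategy U S Z, (∀ i, (abs (η i)).IsRDPStrategy A T (pick i)) →
      ∃ (N : ℕ) (r : RDPResult S Z),
        ¬ (algRun abs η A T ε pick N).Continue ε ∧
        (algRun abs η A T ε pick N).cur = some r ∧
        S.Solves (S.spec φ') T ε (r.umdp.refine A r.strat) r.lower r.upper

/-! #### The set-valued MDP abstraction -/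

/-- The cluster `q_{s,a,c}`: the representatives of the cells that the one-step reachable set of the
cell of `s` and the disturbance region `c` under `a` intersects. -/
def Discretization.cluster (D : Discretization S) (s : S.X) (a : U) (c : Set S.W) : Set D.reps :=
  {s' | (D.cell s' ∩ S.reach (D.cell s) a c).Nonempty}

/-- The SMDP abstraction: for safe `s`, `Γ s a` consists of all `∑_c θ_c P_W(c)`, where `θ_c` is any
probability distribution supported on the cluster `q_{s,a,c}`; the other states are absorbing. -/
def smdp (D : Discretization S) : UMDP S where
  toDiscretization := D
  Γ := fun s a =>
    if s ∈ S.safe then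
      {γ | ∃ θ : Set S.W → D.reps → ℝ,
        (∀ c ∈ D.C, θ c ∈ stdSimplex ℝ D.reps ∧ ∀ s', s' ∉ D.cluster s a c → θ c s' = 0) ∧
        γ = fun s' => ∑ c ∈ D.C, θ c s' * S.PW.real c}
    else {UMDP.pointMass D s}

end StochSystem

end

/-!
The optimal satisfaction probability is squeezed between the two bounds of robust dynamic
programming, and the gap between the bounds tends to zero uniformly.

*Squeezing.* In the set-valued abstraction the discretized true kernel is one of the choices of the
adversary (`smdp_sound`: split the law of the disturbance along the partition of `W` and take
conditional laws). Hence the optimistic values are a supersolution of the dynamic programming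
equation for every controller, and the pessimistic values are a subsolution for the controller that
maximizes them. Along trajectories, whose laws are built one independent disturbance at a time
(`LipschitzDynamics.trajMeasure_succ`), a supersolution is a supermartingale and a subsolution is a
submartingale, so they bound the satisfaction probability (`prob_le_of_supersolution`,
`le_prob_of_subsolution`). As the safety part of the specification fails for good outside the safe
set, the value zero there is exact. This gives `pLow ≤ Pr^κ ≤ Pr^* ≤ pUp` for the refined
controller `κ`, and so any abstraction whose gap is at most `ε` solves the control problem
(`UMDP.solves_of_gap_le`).

*Vanishing gap.* Both bounds are compared with the exact value functions `exactValue`. These are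
continuous off the boundaries of the regions: averaging over the disturbance does not see the
discontinuities of the previous value function, which lie in a Lebesgue null set, because successor
laws have densities (`continuousAt_exactValue`). An element of an ambiguity set puts its mass, for
every `w`, on representatives within `(4 Lf + 2) η` of `f (x, a, w)`. So it integrates a function
`g` as the true kernel does, except where `f (x, a, w)` comes close to a large oscillation of `g`.
For `g` continuous off a null set, the points close to a large oscillation decrease to a null set;
since densities are uniformly bounded and `X_abs` is compact, the probability of reaching them is
small uniformly in `x` and `a` (`exists_trans_oscSet_le`,
`eventually_abs_sum_sub_integral_le`). Induction on the horizon adds up the errors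
(`eventually_exactValue_approx`).

The bound on the ambiguity diameter couples two mixtures by choosing the same part of `W` in both
(`ambiguityDiameter_smdp_le`). An automaton for a formula exists because the truth of the
subformulas can be updated from right to left along a trace with finite memory; the transformations of
this memory induced by the words read so far form a finite automaton reading from left to right
(`LTLf.exists_recognizedBy`).
-/

noncomputable section

/-! ### Automata for LTLf formulas -/

namespace LTLf

variable {AP : Type}

/-- `φ` is decided by a finite automaton reading traces from right to left: `List.foldr` computes a
state from which the truth of `φ` can be read off. -/
def BackwardRecognizable (φ : LTLf AP) : Prop :=
  ∃ (Q : Type) (_ : Finite Q) (step : Set AP → Q → Q) (q₀ : Q) (acc : Set Q),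
    ∀ l, φ.Sat l ↔ l.foldr step q₀ ∈ acc

theorem sat_untl_cons (φ ψ : LTLf AP) (a : Set AP) (l : List (Set AP)) :
    (untl φ ψ).Sat (a :: l) ↔ ψ.Sat (a :: l) ∨ (φ.Sat (a :: l) ∧ (untl φ ψ).Sat l) := by
  constructor
  · rintro ⟨j, hj, h1, h2⟩
    cases j with
    | zero => exact Or.inl (by simpa using h1)
    | succ j =>
      refine Or.inr ⟨by simpa using h2 0 (Nat.succ_pos _), j, by simpa using hj, by simpa using h1,
        fun i hi => ?_⟩
      simpa using h2 (i + 1) (by omega)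
  · rintro (h | ⟨h, j, hj, h1, h2⟩)
    · exact ⟨0, by simp, by simpa using h, by simp⟩
    · refine ⟨j + 1, by simpa using hj, by simpa using h1, fun i hi => ?_⟩
      cases i with
      | zero => simpa using h
      | succ i => simpa using h2 i (by omega)

/-- The truth of a formula at a position depends only on the letter there and on the truth of its
subformulas at the next position, so that a right-to-left pass with finite memory decides it. -/
theorem backwardRecognizable (φ : LTLf AP) : φ.BackwardRecognizable := by
  induction φ with
  | top => exact ⟨Unit, inferInstance, fun _ q => q, (), univ, fun l => by simp [Sat]⟩
  | atom p =>
    refine ⟨Prop, inferInstance, fun a _ => p ∈ a, False, {q | q}, fun l => ?_⟩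
    cases l <;> simp [Sat]
  | neg φ ih =>
    obtain ⟨Q, hQ, st, q₀, acc, h⟩ := ih
    exact ⟨Q, hQ, st, q₀, accᶜ, fun l => by simp [Sat, h]⟩
  | conj φ ψ ih₁ ih₂ =>
    obtain ⟨Q, hQ, st, q₀, acc, h⟩ := ih₁
    obtain ⟨Q', hQ', st', q₀', acc', h'⟩ := ih₂
    have key : ∀ l : List (Set AP),
        l.foldr (fun a (q : Q × Q') => (st a q.1, st' a q.2)) (q₀, q₀') =
          (l.foldr st q₀, l.foldr st' q₀') := by
      intro l
      induction l with
      | nil => rfl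
      | cons a l ih => simp [ih]
    refine ⟨Q × Q', inferInstance, fun a q => (st a q.1, st' a q.2), (q₀, q₀'), acc ×ˢ acc',
      fun l => ?_⟩
    rw [key]
    simp [Sat, h, h']
  | next φ ih =>
    obtain ⟨Q, hQ, st, q₀, acc, h⟩ := ih
    -- the state remembers in addition whether the suffix read is nonempty and satisfies `next φ`
    have key : ∀ l : List (Set AP),
        l.foldr (fun a (q : Q × Prop × Prop) => (st a q.1, True, q.2.1 ∧ q.1 ∈ acc))
          (q₀, False, False) = (l.foldr st q₀, l ≠ [], (next φ).Sat l) := by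
      intro l
      induction l with
      | nil => simp [Sat]
      | cons a l ih => simp [ih, Sat, h, List.length_pos_iff]
    refine ⟨Q × Prop × Prop, inferInstance,
      fun a q => (st a q.1, True, q.2.1 ∧ q.1 ∈ acc), (q₀, False, False), {q | q.2.2},
      fun l => ?_⟩
    rw [key]
    simp
  | untl φ ψ ih₁ ih₂ =>
    obtain ⟨Q, hQ, st, q₀, acc, h⟩ := ih₁
    obtain ⟨Q', hQ', st', q₀', acc', h'⟩ := ih₂
    have key : ∀ l : List (Set AP),
        l.foldr (fun a (q : Q × Q' × Prop) =>
            (st a q.1, st' a q.2.1, st' a q.2.1 ∈ acc' ∨ (st a q.1 ∈ acc ∧ q.2.2)))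
          (q₀, q₀', False) = (l.foldr st q₀, l.foldr st' q₀', (untl φ ψ).Sat l) := by
      intro l
      induction l with
      | nil => simp [Sat]
      | cons a l ih =>
        rw [List.foldr_cons, ih, sat_untl_cons, h, h']
        rfl
    refine ⟨Q × Q' × Prop, inferInstance, fun a q =>
      (st a q.1, st' a q.2.1, st' a q.2.1 ∈ acc' ∨ (st a q.1 ∈ acc ∧ q.2.2)),
      (q₀, q₀', False), {q | q.2.2}, fun l => ?_⟩
    rw [key]
    simp

/-- Every formula has a deterministic automaton: its states are the transformations that the words
read so far induce on the memory of the right-to-left pass. -/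
theorem exists_recognizedBy (φ : LTLf AP) :
    ∃ (Z : Type) (_ : Finite Z) (A : DFA (Set AP) Z), φ.RecognizedBy A := by
  obtain ⟨Q, hQ, st, q₀, acc, h⟩ := φ.backwardRecognizable
  let A : DFA (Set AP) (Q → Q) :=
    { step := fun g a => g ∘ st a
      start := id
      accept := {g | g q₀ ∈ acc} }
  have key : ∀ (l : List (Set AP)) (g : Q → Q) (q : Q), A.evalFrom g l q = g (l.foldr st q) := by
    intro l
    induction l with
    | nil => intro g q; rfl
    | cons a l ih => intro g q; rw [DFA.evalFrom_cons, ih]; rfl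
  refine ⟨Q → Q, inferInstance, A, fun l _ => ?_⟩
  rw [h l]
  change A.evalFrom id l q₀ ∈ acc ↔ _
  rw [key]
  rfl

end LTLf

namespace StochSystem

variable {n d : ℕ} {U AP : Type} {S : StochSystem n d U AP}

/-! ### The dynamics -/

theorem measurableSet_safe (S : StochSystem n d U AP) : MeasurableSet S.safe := by
  have h := S.measurableSet_region (Fin.last S.m)
  rw [S.region_last] at h
  exact h.of_compl

instance (S : StochSystem n d U AP) : CompactSpace S.W := isCompact_iff_compactSpace.1 S.isCompact_W

theorem exists_mem_region (S : StochSystem n d U AP) (x : S.X) : ∃ i, x ∈ S.region i := by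
  have h : x ∈ ⋃ i, S.region i := by rw [S.region_cover]; exact mem_univ x
  exact mem_iUnion.1 h

theorem LipschitzDynamics.continuous {Lf : ℝ} (h : S.LipschitzDynamics Lf) (a : U) :
    Continuous fun p : S.X × S.W => S.f p.1 a p.2 := by
  refine continuous_iff_continuousAt.2 fun p => ?_
  rw [ContinuousAt, tendsto_iff_dist_tendsto_zero]
  have h0 : Tendsto (fun q : S.X × S.W => Lf * (dist q.1 p.1 + dist q.2 p.2)) (𝓝 p) (𝓝 0) := by
    have : Continuous fun q : S.X × S.W => Lf * (dist q.1 p.1 + dist q.2 p.2) := by fun_prop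
    simpa using this.tendsto p
  exact squeeze_zero (fun _ => dist_nonneg) (fun q => h.2 _ _ _ _ _) h0

theorem LipschitzDynamics.measurable {Lf : ℝ} (h : S.LipschitzDynamics Lf) (x : S.X) (a : U) :
    Measurable (S.f x a) :=
  ((h.continuous a).comp (by fun_prop : Continuous fun w : S.W => (x, w))).measurable

theorem f_mem_absSet {x : S.X} (hx : x ∈ S.safe) (a : U) (w : S.W) : S.f x a w ∈ S.absSet :=
  Or.inr ⟨x, hx, a, w, rfl⟩

/-! ### Cells of a discretization -/

namespace Discretization

variable (D : Discretization S)

theorem mem_cell_rho {x : S.X} (hx : x ∈ S.absSet) : x ∈ D.cell (D.rho x) := ⟨hx, rfl⟩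

theorem self_mem_cell {s : S.X} (hs : s ∈ D.reps) : s ∈ D.cell s :=
  ⟨D.reps_subset s hs, D.rho_reps s hs⟩

theorem measurableSet_cell' {s : S.X} (hs : s ∈ D.reps) : MeasurableSet (D.cell s) :=
  D.measurableSet_cell s hs

theorem absSet_eq_iUnion_cell : S.absSet = ⋃ s : D.reps, D.cell s := by
  ext x
  simp only [mem_iUnion]
  exact ⟨fun hx => ⟨⟨D.rho x, D.rho_mem x hx⟩, D.mem_cell_rho hx⟩, fun ⟨s, hs⟩ => hs.1⟩

theorem measurableSet_absSet (D : Discretization S) : MeasurableSet S.absSet := by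
  rw [D.absSet_eq_iUnion_cell]
  exact MeasurableSet.iUnion fun s => D.measurableSet_cell' s.2

theorem mem_region_iff {s x y : S.X} (hs : s ∈ D.reps) (hx : x ∈ D.cell s) (hy : y ∈ D.cell s)
    (i : Fin (S.m + 1)) : x ∈ S.region i ↔ y ∈ S.region i := by
  rcases D.respects s hs i with h | h
  · exact ⟨fun _ => h hy, fun _ => h hx⟩
  · exact ⟨fun h' => absurd h' (h hx), fun h' => absurd h' (h hy)⟩

theorem rho_mem_safe_iff {x : S.X} (hx : x ∈ S.absSet) : D.rho x ∈ S.safe ↔ x ∈ S.safe := by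
  have h := D.mem_region_iff (D.rho_mem x hx) (D.self_mem_cell (D.rho_mem x hx))
    (D.mem_cell_rho hx) (Fin.last S.m)
  rw [S.region_last] at h
  exact not_iff_not.1 h

theorem L_rho {x : S.X} (hx : x ∈ S.absSet) : S.L (D.rho x) = S.L x := by
  obtain ⟨i, hi⟩ := S.exists_mem_region x
  have hs := D.rho_mem x hx
  exact S.L_const i _ ((D.mem_region_iff hs (D.self_mem_cell hs) (D.mem_cell_rho hx) i).2 hi) _ hi

theorem sum_PW : ∑ c ∈ D.C, S.PW.real c = 1 := by
  have h := measureReal_biUnion_finset (μ := S.PW) (s := D.C) (f := id)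
    (D.C_partition.pairwiseDisjoint) D.measurableSet_C
  have hU : ⋃ c ∈ D.C, id c = univ := by
    rw [← D.C_partition.sUnion_eq_univ, sUnion_eq_biUnion]; rfl
  rw [hU, probReal_univ] at h
  exact h.symm

theorem integral_eq_sum_setIntegral {F : S.W → ℝ} (hF : Integrable F S.PW) :
    ∫ w, F w ∂S.PW = ∑ c ∈ D.C, ∫ w in c, F w ∂S.PW := by
  have h := integral_biUnion_finset (μ := S.PW) (f := F) D.C (s := id) D.measurableSet_C
    (D.C_partition.pairwiseDisjoint) (fun c _ => hF.integrableOn)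
  have hU : ⋃ c ∈ D.C, id c = univ := by
    rw [← D.C_partition.sUnion_eq_univ, sUnion_eq_biUnion]; rfl
  rw [hU, setIntegral_univ] at h
  exact h

/-- Averaging over the cells with the discretized kernel is integrating, under the true kernel, a
function that is constant on the cells. -/
theorem sum_cell_mul_eq_integral {x : S.X} (hx : x ∈ S.safe) {a : U} (hm : Measurable (S.f x a))
    (G : S.X → ℝ) :
    ∑ s : D.reps, (S.trans x a).real (D.cell s) * G s = ∫ w, G (D.rho (S.f x a w)) ∂S.PW := by
  have hfun : (fun w => G (D.rho (S.f x a w))) =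
      fun w => ∑ s : D.reps, (S.f x a ⁻¹' D.cell s).indicator (fun _ => G s) w := by
    funext w
    have hw := f_mem_absSet hx a w
    rw [Finset.sum_eq_single ⟨D.rho (S.f x a w), D.rho_mem _ hw⟩]
    · rw [indicator_of_mem]
      exact D.mem_cell_rho hw
    · intro s _ hs
      rw [indicator_of_notMem]
      intro h
      exact hs (Subtype.ext h.2.symm)
    · simp
  rw [hfun, integral_finsetSum]
  · refine Finset.sum_congr rfl fun s _ => ?_
    rw [integral_indicator_const _ (hm (D.measurableSet_cell' s.2)), trans,
      map_measureReal_apply hm (D.measurableSet_cell' s.2), smul_eq_mul]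
  · intro s _
    exact (integrable_const _).indicator (hm (D.measurableSet_cell' s.2))

end Discretization

/-! ### The ambiguity sets of the set-valued abstraction -/

theorem pointMass_mem_stdSimplex (D : Discretization S) {s : S.X} (hs : s ∈ D.reps) :
    UMDP.pointMass D s ∈ stdSimplex ℝ D.reps := by
  refine ⟨fun s' => ?_, ?_⟩
  · unfold UMDP.pointMass
    split_ifs <;> norm_num
  · unfold UMDP.pointMass
    rw [Finset.sum_eq_single ⟨s, hs⟩]
    · simp
    · intro b _ hb
      exact if_neg fun h => hb (Subtype.ext h)
    · simp

/-- Every cluster is nonempty, since cells and elements of the partition of `W` are. -/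
theorem cluster_nonempty (D : Discretization S) {s : S.X} (hs : s ∈ D.reps) (hsafe : s ∈ S.safe)
    (a : U) {c : Set S.W} (hc : c ∈ D.C) : (D.cluster s a c).Nonempty := by
  obtain ⟨w, hw⟩ := Setoid.nonempty_of_mem_partition D.C_partition hc
  have hy := f_mem_absSet hsafe a w
  exact ⟨⟨D.rho (S.f s a w), D.rho_mem _ hy⟩, S.f s a w, D.mem_cell_rho hy,
    s, D.self_mem_cell hs, w, hw, rfl⟩

/-- The probability distributions supported on a cluster. -/
def clusterSimplex (D : Discretization S) (s : S.X) (a : U) (c : Set S.W) : Set (D.reps → ℝ) :=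
  {θ | θ ∈ stdSimplex ℝ D.reps ∧ ∀ s', s' ∉ D.cluster s a c → θ s' = 0}

theorem clusterSimplex_nonempty (D : Discretization S) {s : S.X} (hs : s ∈ D.reps)
    (hsafe : s ∈ S.safe) (a : U) {c : Set S.W} (hc : c ∈ D.C) :
    (clusterSimplex D s a c).Nonempty := by
  obtain ⟨q, hq⟩ := cluster_nonempty D hs hsafe a hc
  refine ⟨Pi.single q 1, single_mem_stdSimplex ℝ q, fun s' hs' => ?_⟩
  rw [Pi.single_eq_of_ne]
  rintro rfl
  exact hs' hq

theorem isCompact_clusterSimplex (D : Discretization S) (s : S.X) (a : U) (c : Set S.W) :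
    IsCompact (clusterSimplex D s a c) := by
  refine (isCompact_stdSimplex ℝ D.reps).inter_right (t := {θ | ∀ s', s' ∉ D.cluster s a c →
    θ s' = 0}) ?_
  simp only [ofPred_forall]
  exact isClosed_iInter fun s' => isClosed_iInter fun _ =>
    isClosed_eq (continuous_apply s') continuous_const

theorem smdp_Γ_of_mem_safe (D : Discretization S) {s : S.X} (hsafe : s ∈ S.safe) (a : U) :
    (smdp D).Γ s a = {γ | ∃ θ : Set S.W → D.reps → ℝ,
      (∀ c ∈ D.C, θ c ∈ clusterSimplex D s a c) ∧
      γ = fun s' => ∑ c ∈ D.C, θ c s' * S.PW.real c} := if_pos hsafe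

theorem smdp_Γ_of_notMem_safe (D : Discretization S) {s : S.X} (hsafe : s ∉ S.safe) (a : U) :
    (smdp D).Γ s a = {UMDP.pointMass D s} := if_neg hsafe

/-- The ambiguity set of a safe state is a Minkowski sum of finitely many compact sets. -/
theorem isCompact_smdp_Γ (D : Discretization S) {s : S.X} (hsafe : s ∈ S.safe) (a : U) :
    IsCompact ((smdp D).Γ s a) := by
  have h : (smdp D).Γ s a = (fun (θ : D.C → D.reps → ℝ) (s' : D.reps) =>
      ∑ c : D.C, θ c s' * S.PW.real (c : Set S.W)) ''
        univ.pi fun c : D.C => clusterSimplex D s a c := by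
    rw [smdp_Γ_of_mem_safe D hsafe]
    ext γ
    constructor
    · rintro ⟨θ, hθ, rfl⟩
      refine ⟨fun c => θ c, fun c _ => hθ c c.2, ?_⟩
      funext s'
      exact Finset.sum_coe_sort D.C fun c => θ c s' * S.PW.real c
    · rintro ⟨θ, hθ, rfl⟩
      refine ⟨fun c => if hc : c ∈ D.C then θ ⟨c, hc⟩ else 0, fun c hc => ?_, ?_⟩
      · dsimp only
        rw [dif_pos hc]
        exact hθ ⟨c, hc⟩ (mem_univ _)
      · funext s'
        rw [← Finset.sum_coe_sort D.C]
        refine Finset.sum_congr rfl fun c _ => ?_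
        dsimp only
        rw [dif_pos c.2]
  rw [h]
  refine (isCompact_univ_pi fun c : D.C => isCompact_clusterSimplex D s a (c : Set S.W)).image ?_
  fun_prop

theorem smdp_wellFormed (D : Discretization S) : (smdp D).WellFormed := by
  intro s hs a
  by_cases hsafe : s ∈ S.safe
  · refine ⟨?_, (isCompact_smdp_Γ D hsafe a).isClosed, ?_⟩
    · rw [smdp_Γ_of_mem_safe D hsafe]
      choose! θ hθ using fun c (hc : c ∈ D.C) => clusterSimplex_nonempty D hs hsafe a hc
      exact ⟨_, θ, hθ, rfl⟩
    · rw [smdp_Γ_of_mem_safe D hsafe]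
      rintro γ ⟨θ, hθ, rfl⟩
      refine ⟨fun s' => Finset.sum_nonneg fun c hc =>
        mul_nonneg ((hθ c hc).1.1 s') measureReal_nonneg, ?_⟩
      change ∑ s' : D.reps, ∑ c ∈ D.C, θ c s' * S.PW.real c = 1
      rw [Finset.sum_comm, ← D.sum_PW]
      refine Finset.sum_congr rfl fun c hc => ?_
      rw [← Finset.sum_mul, (hθ c hc).1.2, one_mul]
  · rw [smdp_Γ_of_notMem_safe D hsafe]
    exact ⟨singleton_nonempty _, isClosed_singleton,
      singleton_subset_iff.2 (pointMass_mem_stdSimplex D hs)⟩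

/-- The discretized kernel lies in the ambiguity set: for the part `c` of `W`, take the conditional
law of the cell of the successor given `w ∈ c`. -/
theorem smdp_sound {Lf : ℝ} (hlip : S.LipschitzDynamics Lf) (D : Discretization S) :
    (smdp D).Sound := by
  refine ⟨fun x hx a => ?_, fun x hx hxs a =>
    smdp_Γ_of_notMem_safe D (fun h => hxs ((D.rho_mem_safe_iff hx).1 h)) a⟩
  have hxa : x ∈ S.absSet := Or.inl hx
  have hm := hlip.measurable x a
  have hsafe : D.rho x ∈ S.safe := (D.rho_mem_safe_iff hxa).2 hx
  have hmc : ∀ s : D.reps, MeasurableSet (S.f x a ⁻¹' D.cell s) := fun s =>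
    hm (D.measurableSet_cell' s.2)
  have hdisj : Pairwise fun s s' : D.reps =>
      Disjoint (S.f x a ⁻¹' D.cell s) (S.f x a ⁻¹' D.cell s') := by
    intro s s' hss
    rw [Set.disjoint_left]
    exact fun w h h' => hss (Subtype.ext (h.2.symm.trans h'.2))
  have hcover : ∀ c : Set S.W, c = ⋃ s : D.reps, c ∩ S.f x a ⁻¹' D.cell s := by
    intro c
    rw [← inter_iUnion, ← preimage_iUnion, ← D.absSet_eq_iUnion_cell]
    exact (inter_eq_left.2 fun w _ => f_mem_absSet hx a w).symm
  rw [show (smdp D).rho = D.rho from rfl, smdp_Γ_of_mem_safe D hsafe]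
  choose! θ₀ hθ₀ using fun c (hc : c ∈ D.C) =>
    clusterSimplex_nonempty D (D.rho_mem x hxa) hsafe a hc
  -- on a null part the conditional law is undefined, and any distribution on the cluster will do
  refine ⟨fun c => if S.PW.real c = 0 then θ₀ c else
    fun s' => S.PW.real (c ∩ S.f x a ⁻¹' D.cell s') / S.PW.real c, fun c hc => ?_, ?_⟩
  · dsimp only
    split_ifs with h0
    · exact hθ₀ c hc
    · refine ⟨⟨fun s' => div_nonneg measureReal_nonneg measureReal_nonneg, ?_⟩, fun s' hs' => ?_⟩
      · rw [← Finset.sum_div, div_eq_one_iff_eq h0]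
        have h := measureReal_biUnion_finset (μ := S.PW) (s := Finset.univ)
          (f := fun s : D.reps => c ∩ S.f x a ⁻¹' D.cell s)
          (fun s _ s' _ hss => (hdisj hss).mono inter_subset_right inter_subset_right)
          (fun s _ => (D.measurableSet_C c hc).inter (hmc s))
        simp only [Finset.mem_univ, iUnion_true] at h
        rw [← h, ← hcover c]
      · have : c ∩ S.f x a ⁻¹' D.cell s' = ∅ := by
          rw [eq_empty_iff_forall_notMem]
          exact fun w hw => hs' ⟨S.f x a w, hw.2, x, D.mem_cell_rho hxa, w, hw.1, rfl⟩
        simp [this]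
  · funext s'
    have h := D.integral_eq_sum_setIntegral
      ((integrable_const (1 : ℝ)).indicator (μ := S.PW) (hmc s'))
    rw [integral_indicator_const _ (hmc s')] at h
    change (S.trans x a).real (D.cell s') = _
    rw [trans, map_measureReal_apply hm (D.measurableSet_cell' s'.2)]
    rw [smul_eq_mul, mul_one] at h
    rw [h]
    refine Finset.sum_congr rfl fun c hc => ?_
    rw [integral_indicator_const _ (hmc s'), smul_eq_mul, mul_one,
      measureReal_restrict_apply (hmc s'), inter_comm]
    dsimp only
    split_ifs with h0
    · rw [h0, mul_zero]
      exact le_antisymm (h0 ▸ measureReal_mono inter_subset_left) measureReal_nonneg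
    · rw [div_mul_cancel₀ _ h0]

/-! ### The ambiguity diameter -/

/-- A transport plan that moves mass only between points at distance at most `r` bounds the
Wasserstein distance of its marginals by `r`. -/
theorem wasserstein_toMeasure_le (D : Discretization S) {γ γ' : D.reps → ℝ}
    (p : D.reps → D.reps → ℝ) (hp : ∀ s s', 0 ≤ p s s') (h₁ : ∀ s, ∑ s', p s s' = γ s)
    (h₂ : ∀ s', ∑ s, p s s' = γ' s') (hsum : ∑ s, γ s = 1) {r : ℝ}
    (hr : ∀ s s', p s s' ≠ 0 → dist (s : S.X) s' ≤ r) :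
    wasserstein (UMDP.toMeasure D γ) (UMDP.toMeasure D γ') ≤ ENNReal.ofReal r := by
  let π : Measure (S.X × S.X) := ∑ q : D.reps × D.reps,
    ENNReal.ofReal (p q.1 q.2) • Measure.dirac ((q.1 : S.X), (q.2 : S.X))
  have hπ₁ : π.map Prod.fst = UMDP.toMeasure D γ := by
    rw [Measure.map_finset_sum (by fun_prop), UMDP.toMeasure, Fintype.sum_prod_type]
    refine Finset.sum_congr rfl fun s _ => ?_
    simp only [Measure.map_smul, Measure.map_dirac' measurable_fst]
    rw [← Finset.sum_smul, ← ENNReal.ofReal_sum_of_nonneg fun s' _ => hp s s', h₁]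
  have hπ₂ : π.map Prod.snd = UMDP.toMeasure D γ' := by
    rw [Measure.map_finset_sum (by fun_prop), UMDP.toMeasure, Fintype.sum_prod_type_right]
    refine Finset.sum_congr rfl fun s' _ => ?_
    simp only [Measure.map_smul, Measure.map_dirac' measurable_snd]
    rw [← Finset.sum_smul, ← ENNReal.ofReal_sum_of_nonneg fun s _ => hp s s', h₂]
  refine (iInf₂_le π ⟨hπ₁, hπ₂⟩).trans ?_
  rw [lintegral_finsetSum_measure]
  simp only [lintegral_smul_measure, lintegral_dirac, smul_eq_mul]
  calc ∑ q : D.reps × D.reps, ENNReal.ofReal (p q.1 q.2) * edist (q.1 : S.X) (q.2 : S.X)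
      ≤ ∑ q : D.reps × D.reps, ENNReal.ofReal (p q.1 q.2) * ENNReal.ofReal r := by
        refine Finset.sum_le_sum fun q _ => ?_
        by_cases h0 : p q.1 q.2 = 0
        · simp [h0]
        · gcongr
          rw [edist_dist]
          exact ENNReal.ofReal_le_ofReal (hr _ _ h0)
    _ = ENNReal.ofReal r := by
        rw [← Finset.sum_mul, ← ENNReal.ofReal_sum_of_nonneg fun q _ => hp q.1 q.2,
          Fintype.sum_prod_type]
        simp only [h₁, hsum, ENNReal.ofReal_one, one_mul]

/-- The ambiguity diameter is at most the largest diameter of a cluster: couple two mixtures by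
choosing the same part of `W` in both. -/
theorem ambiguityDiameter_smdp_le (D : Discretization S) {r : ℝ}
    (hr : ∀ s ∈ D.reps, s ∈ S.safe → ∀ a, ∀ c ∈ D.C, ∀ q ∈ D.cluster s a c,
      ∀ q' ∈ D.cluster s a c, dist (q : S.X) q' ≤ r) :
    (smdp D).ambiguityDiameter ≤ ENNReal.ofReal r := by
  refine iSup₂_le fun s hs => iSup_le fun a => iSup₂_le fun γ hγ => iSup₂_le fun γ' hγ' => ?_
  have hsum := ((smdp_wellFormed D s hs.1 a).2.2 hγ).2
  rw [smdp_Γ_of_mem_safe D hs.2] at hγ hγ'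
  obtain ⟨θ, hθ, rfl⟩ := hγ
  obtain ⟨θ', hθ', rfl⟩ := hγ'
  refine wasserstein_toMeasure_le D
    (fun q q' => ∑ c ∈ D.C, θ c q * θ' c q' * S.PW.real c) (fun q q' =>
      Finset.sum_nonneg fun c hc =>
        mul_nonneg (mul_nonneg ((hθ c hc).1.1 q) ((hθ' c hc).1.1 q')) measureReal_nonneg)
    (fun q => ?_) (fun q' => ?_) hsum fun q q' hq => ?_
  · rw [Finset.sum_comm]
    refine Finset.sum_congr rfl fun c hc => ?_
    rw [← Finset.sum_mul, ← Finset.mul_sum, (hθ' c hc).1.2, mul_one]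
  · rw [Finset.sum_comm]
    refine Finset.sum_congr rfl fun c hc => ?_
    rw [← Finset.sum_mul, ← Finset.sum_mul, (hθ c hc).1.2, one_mul]
  · obtain ⟨c, hc, h0⟩ := Finset.exists_ne_zero_of_sum_ne_zero hq
    refine hr s hs.1 hs.2 a c hc q ?_ q' ?_
    · by_contra h
      exact h0 (by simp [(hθ c hc).2 q h])
    · by_contra h
      exact h0 (by simp [(hθ' c hc).2 q' h])

/-- Points of a one-step reachable set are close to each other. -/
theorem dist_reach_le {Lf η : ℝ} (hlip : S.LipschitzDynamics Lf) {D : Discretization S}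
    (hD : D.SizeLE η) {s : S.X} (hs : s ∈ D.reps) {a : U} {c : Set S.W} (hc : c ∈ D.C) {y y' : S.X}
    (hy : y ∈ S.reach (D.cell s) a c) (hy' : y' ∈ S.reach (D.cell s) a c) :
    dist y y' ≤ 4 * Lf * η := by
  obtain ⟨x, hx, w, hw, rfl⟩ := hy
  obtain ⟨x', hx', w', hw', rfl⟩ := hy'
  have h1 := hD.1 s hs x hx x' hx'
  have h2 := hD.2 c hc w hw w' hw'
  have h3 := hlip.2 x x' a w w'
  have h4 := mul_le_mul_of_nonneg_left (add_le_add h1 h2) hlip.1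
  linarith

/-- If every cell lies within `ρ` of its representative, a cluster has diameter at most
`4 Lf η + 2 ρ`: its cells meet a common reachable set. -/
theorem dist_cluster_le {Lf η ρ : ℝ} (hlip : S.LipschitzDynamics Lf) {D : Discretization S}
    (hD : D.SizeLE η) (hρ : ∀ s ∈ D.reps, ∀ x ∈ D.cell s, dist x s ≤ ρ)
    {s : S.X} (hs : s ∈ D.reps) {a : U} {c : Set S.W} (hc : c ∈ D.C) {q q' : D.reps}
    (hq : q ∈ D.cluster s a c) (hq' : q' ∈ D.cluster s a c) :
    dist (q : S.X) q' ≤ 4 * Lf * η + 2 * ρ := by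
  obtain ⟨y, hy, hyr⟩ := hq
  obtain ⟨y', hy', hyr'⟩ := hq'
  have h1 := dist_reach_le hlip hD hs hc hyr hyr'
  have h2 := hρ q q.2 y hy
  have h3 := hρ q' q'.2 y' hy'
  have h4 := dist_triangle4 (q : S.X) y y' q'
  rw [dist_comm (q : S.X) y] at h4
  linarith

theorem ambiguityDiameter_smdp_le_of_sizeLE {Lf η : ℝ} (hlip : S.LipschitzDynamics Lf)
    {D : Discretization S} (hD : D.SizeLE η) :
    (smdp D).ambiguityDiameter ≤ ENNReal.ofReal ((4 * Lf + 4) * η) := by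
  refine ambiguityDiameter_smdp_le D fun s hs _ a c hc q hq q' hq' => ?_
  have := dist_cluster_le hlip hD (fun s hs x hx => hD.1 s hs x hx s (D.self_mem_cell hs)) hs hc
    hq hq'
  linarith

theorem ambiguityDiameter_smdp_le_of_centered {Lf η : ℝ} (hlip : S.LipschitzDynamics Lf)
    {D : Discretization S} (hD : D.SizeLE η) (hc : D.Centered η) :
    (smdp D).ambiguityDiameter ≤ ENNReal.ofReal ((4 * Lf + 2) * η) := by
  refine ambiguityDiameter_smdp_le D fun s hs _ a c hc' q hq q' hq' => ?_
  have := dist_cluster_le hlip hD hc hs hc' hq hq'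
  linarith

/-! ### Measurability of labels and traces -/

/-- Every property of a finite sequence of labels is measurable, since labels are constant on the
finitely many measurable regions. -/
theorem measurableSet_labels (S : StochSystem n d U AP) {Ω ι : Type} [MeasurableSpace Ω] [Finite ι]
    {x : Ω → ι → S.X} (hx : ∀ i, Measurable fun ω => x ω i) (P : (ι → Set AP) → Prop) :
    MeasurableSet {ω | P fun i => S.L (x ω i)} := by
  choose idx hidx using S.exists_mem_region
  have hidx_meas : Measurable idx := by
    refine measurable_to_countable' fun i => ?_
    have : idx ⁻¹' {i} = S.region i := by
      ext y
      refine ⟨fun h => ?_, fun h => ?_⟩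
      · rw [mem_preimage, mem_singleton_iff] at h
        exact h ▸ hidx y
      · by_contra hne
        exact Set.disjoint_left.1 (S.region_disjoint hne) (hidx y) h
    rw [this]
    exact S.measurableSet_region i
  let lab : Fin (S.m + 1) → Set AP := fun i =>
    if h : (S.region i).Nonempty then S.L h.some else ∅
  have hlab : ∀ y, lab (idx y) = S.L y := fun y => by
    have h : (S.region (idx y)).Nonempty := ⟨y, hidx y⟩
    simp only [lab, dif_pos h]
    exact S.L_const _ _ h.some_mem _ (hidx y)
  have hm : Measurable fun ω i => idx (x ω i) := measurable_pi_lambda _ fun i =>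
    hidx_meas.comp (hx i)
  have : {ω | P fun i => S.L (x ω i)} =
      (fun ω i => idx (x ω i)) ⁻¹' {j | P fun i => lab (j i)} := by
    ext ω
    simp [hlab]
  rw [this]
  exact hm (Set.toFinite _).measurableSet

theorem measurableSet_label (S : StochSystem n d U AP) (P : Set AP → Prop) :
    MeasurableSet {y | P (S.L y)} :=
  S.measurableSet_labels (ι := Unit) (x := fun y _ => y) (fun _ => measurable_id) fun l => P (l ())

theorem measurableSet_trace [MeasurableSpace U] {t : ℕ} (P : List (Set AP) → Prop) :
    MeasurableSet {ω : S.Traj t | P (S.trace ω)} :=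
  S.measurableSet_labels (x := fun (ω : S.Traj t) i => ω.1 i) (fun i => by fun_prop)
    fun l => P (List.ofFn l)

/-- A real function of a state and an automaton state may be evaluated along measurable data. -/
theorem measurable_comp_finite {Ω Y Z : Type} [MeasurableSpace Ω] [MeasurableSpace Y] [Finite Z]
    {v : Y → Z → ℝ} (hv : ∀ z, Measurable fun y => v y z) {y : Ω → Y} (hy : Measurable y)
    {z : Ω → Z} (hz : ∀ z₀, MeasurableSet {ω | z ω = z₀}) : Measurable fun ω => v (y ω) (z ω) := by
  let : MeasurableSpace Z := ⊤
  have hz' : Measurable z := measurable_to_countable' hz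
  have hv' : Measurable fun p : Y × Z => v p.1 p.2 := measurable_from_prod_countable_left hv
  exact hv'.comp (hy.prodMk hz')

theorem measurable_stepValue {Z : Type} [Finite Z] (A : DFA (Set AP) Z) {v : S.X → Z → ℝ}
    (hv : ∀ z, Measurable fun x => v x z) (z : Z) :
    Measurable fun y => v y (A.step z (S.L y)) :=
  measurable_comp_finite hv measurable_id fun z₀ => S.measurableSet_label fun l => A.step z l = z₀

/-! ### The law of trajectories -/

/-- One more step of a trajectory under the policy `κ`, for the disturbance `p.2`. -/
def extend (κ : S.Policy) (t : ℕ) (p : S.Traj t × S.W) : S.Traj (t + 1) :=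
  (Fin.snoc (α := fun _ => S.X) p.1.1 (S.f (p.1.1 (Fin.last t)) (κ t p.1) p.2),
    Fin.snoc (α := fun _ => U) p.1.2 (κ t p.1))

theorem traj_succ (κ : S.Policy) (x₀ : S.X) (w : ℕ → S.W) (t : ℕ) :
    S.traj κ x₀ w (t + 1) = extend κ t (S.traj κ x₀ w t, w t) := rfl

theorem traj_congr (κ : S.Policy) (x₀ : S.X) {w w' : ℕ → S.W} {t : ℕ} (h : ∀ i < t, w i = w' i) :
    S.traj κ x₀ w t = S.traj κ x₀ w' t := by
  induction t with
  | zero => rfl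
  | succ t ih =>
    rw [traj_succ, traj_succ, ih fun i hi => h i (by omega), h t (by omega)]

theorem extend_last (κ : S.Policy) {t : ℕ} (p : S.Traj t × S.W) :
    (extend κ t p).1 (Fin.last (t + 1)) = S.f (p.1.1 (Fin.last t)) (κ t p.1) p.2 := by
  simp [extend]

theorem trace_extend (κ : S.Policy) {t : ℕ} (p : S.Traj t × S.W) :
    S.trace (extend κ t p) =
      S.trace p.1 ++ [S.L (S.f (p.1.1 (Fin.last t)) (κ t p.1) p.2)] := by
  rw [trace, List.ofFn_succ', List.concat_eq_append, extend_last]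
  simp [trace, extend]

section
variable [MeasurableSpace U]

theorem LipschitzDynamics.measurable_extend [Finite U] [DiscreteMeasurableSpace U] {Lf : ℝ}
    (hlip : S.LipschitzDynamics Lf) {κ : S.Policy} (hκ : S.IsController κ) (t : ℕ) :
    Measurable (extend κ t) := by
  have hf : Measurable fun q : (S.X × S.W) × U => S.f q.1.1 q.2 q.1.2 :=
    measurable_from_prod_countable_left fun a => (hlip.continuous a).measurable
  have hκ' : Measurable fun p : S.Traj t × S.W => κ t p.1 := (hκ t).comp measurable_fst
  have hy : Measurable fun p : S.Traj t × S.W => S.f (p.1.1 (Fin.last t)) (κ t p.1) p.2 :=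
    hf.comp (g := fun q : (S.X × S.W) × U => S.f q.1.1 q.2 q.1.2)
      (f := fun p : S.Traj t × S.W => ((p.1.1 (Fin.last t), p.2), κ t p.1))
      (Measurable.prodMk (by fun_prop) hκ')
  refine Measurable.prodMk (measurable_pi_lambda _ fun i => ?_) (measurable_pi_lambda _ fun i => ?_)
  · refine Fin.lastCases ?_ (fun j => ?_) i
    · simpa using hy
    · simpa using (by fun_prop : Measurable fun p : S.Traj t × S.W => p.1.1 j)
  · refine Fin.lastCases ?_ (fun j => ?_) i
    · simpa using hκ'
    · simpa using (by fun_prop : Measurable fun p : S.Traj t × S.W => p.1.2 j)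

theorem LipschitzDynamics.measurable_traj [Finite U] [DiscreteMeasurableSpace U] {Lf : ℝ}
    (hlip : S.LipschitzDynamics Lf) {κ : S.Policy} (hκ : S.IsController κ) (x₀ : S.X) (t : ℕ) :
    Measurable fun w => S.traj κ x₀ w t := by
  induction t with
  | zero => exact measurable_const
  | succ t ih =>
    exact (hlip.measurable_extend hκ t).comp (ih.prodMk (measurable_pi_apply t))

/-- The trajectory up to time `t` is independent of the disturbance `w_t`. -/
theorem LipschitzDynamics.trajMeasure_succ [Finite U] [DiscreteMeasurableSpace U] {Lf : ℝ}
    (hlip : S.LipschitzDynamics Lf) {κ : S.Policy} (hκ : S.IsController κ) (x₀ : S.X) (t : ℕ) :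
    S.trajMeasure κ x₀ (t + 1) = ((S.trajMeasure κ x₀ t).prod S.PW).map (extend κ t) := by
  set μ := Measure.infinitePi fun _ : ℕ => S.PW with hμ
  have hmeas := hlip.measurable_traj hκ x₀ t
  obtain ⟨w₀⟩ : Nonempty S.W := nonempty_of_isProbabilityMeasure S.PW
  have hind : ProbabilityTheory.iIndepFun (fun (i : ℕ) (w : ℕ → S.W) => w i) μ :=
    ProbabilityTheory.iIndepFun_infinitePi (P := fun _ : ℕ => S.PW)
      (X := fun _ (w : S.W) => w) (fun _ => measurable_id)
  have hfin := hind.indepFun_finset (Finset.range t) {t} (by simp)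
    (fun i => measurable_pi_apply i)
  -- the trajectory up to time `t` as a function of `w_0, …, w_{t-1}` only
  let pad : (Finset.range t → S.W) → ℕ → S.W := fun v i =>
    if h : i ∈ Finset.range t then v ⟨i, h⟩ else w₀
  have hpad : Measurable pad := measurable_pi_lambda _ fun i => by
    by_cases h : i ∈ Finset.range t
    · simp only [pad, dif_pos h]
      exact measurable_pi_apply (⟨i, h⟩ : Finset.range t)
    · simp only [pad, dif_neg h]
      exact measurable_const
  have hI : ProbabilityTheory.IndepFun (fun w => S.traj κ x₀ w t) (fun w : ℕ → S.W => w t) μ := by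
    have h := hfin.comp (hmeas.comp hpad)
      (measurable_pi_apply (⟨t, Finset.mem_singleton_self t⟩ : ({t} : Finset ℕ)))
    have heq : (fun w => S.traj κ x₀ w t) =
        ((fun w => S.traj κ x₀ w t) ∘ pad) ∘ fun (w : ℕ → S.W) (i : Finset.range t) => w i := by
      funext w
      refine traj_congr κ x₀ fun i hi => ?_
      simp [pad, hi]
    rw [heq]
    exact h
  have hprod := hI.map_prod_eq_prod_map_map hmeas.aemeasurable
    (measurable_pi_apply t).aemeasurable
  rw [hμ, Measure.infinitePi_map_eval, ← hμ] at hprod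
  change μ.map (extend κ t ∘ fun w => (S.traj κ x₀ w t, w t)) = _
  rw [← Measure.map_map (hlip.measurable_extend hκ t) (hmeas.prodMk (measurable_pi_apply t)), hprod]
  rfl

theorem LipschitzDynamics.isProbabilityMeasure_trajMeasure [Finite U] [DiscreteMeasurableSpace U]
    {Lf : ℝ} (hlip : S.LipschitzDynamics Lf) {κ : S.Policy} (hκ : S.IsController κ) (x₀ : S.X)
    (t : ℕ) : IsProbabilityMeasure (S.trajMeasure κ x₀ t) :=
  Measure.isProbabilityMeasure_map (hlip.measurable_traj hκ x₀ t).aemeasurable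

end

/-! ### Satisfaction along trajectories -/

theorem mem_of_spec_sat {φ' : LTLf AP} {l : List (Set AP)} (h : (S.spec φ').Sat l) :
    ∀ a ∈ l, S.pSafe ∈ a := by
  intro a ha
  obtain ⟨j, hj, rfl⟩ := List.mem_iff_getElem.1 ha
  by_contra hn
  refine h.1 ⟨j, hj, ?_, fun i _ => trivial⟩
  simp [LTLf.Sat, List.head?_drop, List.getElem?_eq_getElem hj, hn]

theorem safe_of_sat_trace {φ' : LTLf AP} {t : ℕ} {ω : S.Traj t}
    (h : (S.spec φ').Sat (S.trace ω)) (i : Fin (t + 1)) : ω.1 i ∈ S.safe :=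
  (S.pSafe_mem _).1 (mem_of_spec_sat h _ (List.mem_ofFn.2 ⟨i, rfl⟩))

theorem trace_ne_nil {t : ℕ} (ω : S.Traj t) : S.trace ω ≠ [] := by
  simp [trace]

theorem trajSat_extend_iff {φ : LTLf AP} (κ : S.Policy) {t : ℕ} (p : S.Traj t × S.W) :
    S.TrajSat (extend κ t p) φ ↔ S.TrajSat p.1 φ ∨ φ.Sat (S.trace (extend κ t p)) := by
  constructor
  · rintro ⟨l, hl, hne, hs⟩
    rw [trace_extend, List.prefix_concat_iff] at hl
    rcases hl with rfl | hl
    · exact Or.inr (by rwa [trace_extend])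
    · exact Or.inl ⟨l, hl, hne, hs⟩
  · rintro (⟨l, hl, hne, hs⟩ | h)
    · exact ⟨l, hl.trans (by rw [trace_extend]; exact List.prefix_append _ _), hne, hs⟩
    · exact ⟨_, List.prefix_rfl, trace_ne_nil _, h⟩

theorem forall_extend_safe_iff (κ : S.Policy) {t : ℕ} (p : S.Traj t × S.W) :
    (∀ i, (extend κ t p).1 i ∈ S.safe) ↔
      (∀ i, p.1.1 i ∈ S.safe) ∧ S.f (p.1.1 (Fin.last t)) (κ t p.1) p.2 ∈ S.safe := by
  rw [Fin.forall_fin_succ', extend_last]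
  simp [extend]

/-! ### Comparison of satisfaction probabilities with value functions -/

variable {Z : Type}

/-- The properties shared by all value functions on the product with the automaton `A`. -/
structure IsValue (S : StochSystem n d U AP) (A : DFA (Set AP) Z) (v : S.X → Z → ℝ) : Prop where
  measurable : ∀ z, Measurable fun x => v x z
  mem_Icc : ∀ x z, v x z ∈ Icc (0 : ℝ) 1
  eq_one : ∀ x ∈ S.safe, ∀ z ∈ A.accept, v x z = 1
  eq_zero : ∀ x ∉ S.safe, ∀ z ∉ A.accept, v x z = 0

/-- The value function for horizon zero: the indicator function of acceptance. -/
def acceptValue (S : StochSystem n d U AP) (A : DFA (Set AP) Z) : S.X → Z → ℝ :=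
  fun _ z => if z ∈ A.accept then 1 else 0

theorem isValue_acceptValue (S : StochSystem n d U AP) (A : DFA (Set AP) Z) :
    IsValue S A (acceptValue S A) where
  measurable _ := measurable_const
  mem_Icc _ z := by
    unfold acceptValue
    split_ifs <;> simp
  eq_one _ _ _ hz := if_pos hz
  eq_zero _ _ _ hz := if_neg hz

/-- The conditional probability of satisfaction given the trajectory so far, when it is `v` as long
as the specification is neither satisfied nor violated for good by leaving the safe set. -/
def valueAlong (φ : LTLf AP) (A : DFA (Set AP) Z) (v : S.X → Z → ℝ) {t : ℕ} (ω : S.Traj t) : ℝ :=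
  if S.TrajSat ω φ then 1
  else if ∀ i, ω.1 i ∈ S.safe then v (ω.1 (Fin.last t)) (A.eval (S.trace ω)) else 0

theorem valueAlong_mem_Icc (φ : LTLf AP) {A : DFA (Set AP) Z} {v : S.X → Z → ℝ}
    (hv : IsValue S A v) {t : ℕ} (ω : S.Traj t) : valueAlong φ A v ω ∈ Icc (0 : ℝ) 1 := by
  unfold valueAlong
  split_ifs
  · simp
  · exact hv.mem_Icc _ _
  · simp

theorem measurable_valueAlong [MeasurableSpace U] [Finite Z] (φ : LTLf AP) {A : DFA (Set AP) Z}
    {v : S.X → Z → ℝ} (hv : IsValue S A v) (t : ℕ) :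
    Measurable fun ω : S.Traj t => valueAlong φ A v ω := by
  have h1 : MeasurableSet {ω : S.Traj t | S.TrajSat ω φ} :=
    measurableSet_trace fun l => ∃ l', l' <+: l ∧ l' ≠ [] ∧ φ.Sat l'
  have h2 : MeasurableSet {ω : S.Traj t | ∀ i, ω.1 i ∈ S.safe} := by
    simp only [ofPred_forall]
    refine MeasurableSet.iInter fun i => ?_
    exact (by fun_prop : Measurable fun ω : S.Traj t => ω.1 i) S.measurableSet_safe
  refine Measurable.ite h1 measurable_const (Measurable.ite h2 ?_ measurable_const)
  exact measurable_comp_finite hv.measurable (by fun_prop)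
    fun z₀ => measurableSet_trace fun l => A.eval l = z₀

theorem integrable_of_mem_Icc {Ω : Type} [MeasurableSpace Ω] {μ : Measure Ω} [IsFiniteMeasure μ]
    {g : Ω → ℝ} (hg : Measurable g) (h : ∀ ω, g ω ∈ Icc (0 : ℝ) 1) : Integrable g μ :=
  Integrable.of_mem_Icc 0 1 hg.aemeasurable (Eventually.of_forall h)

theorem valueAlong_extend_of_trajSat {φ : LTLf AP} (A : DFA (Set AP) Z) (v : S.X → Z → ℝ)
    (κ : S.Policy) {t : ℕ} {ω : S.Traj t} (h : S.TrajSat ω φ) (w : S.W) :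
    valueAlong φ A v (extend κ t (ω, w)) = 1 :=
  if_pos ((trajSat_extend_iff κ _).2 (Or.inl h))

theorem valueAlong_extend_of_not_safe {φ' : LTLf AP} (A : DFA (Set AP) Z) (v : S.X → Z → ℝ)
    (κ : S.Policy) {t : ℕ} {ω : S.Traj t} (h : ¬ S.TrajSat ω (S.spec φ'))
    (hs : ¬ ∀ i, ω.1 i ∈ S.safe) (w : S.W) :
    valueAlong (S.spec φ') A v (extend κ t (ω, w)) = 0 := by
  have hs' : ¬ ∀ i, (extend κ t (ω, w)).1 i ∈ S.safe := fun h' =>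
    hs ((forall_extend_safe_iff κ _).1 h').1
  rw [valueAlong, if_neg, if_neg hs']
  rw [trajSat_extend_iff, not_or]
  exact ⟨h, fun h' => hs' fun i => safe_of_sat_trace h' i⟩

theorem valueAlong_extend_of_safe {φ' : LTLf AP} {A : DFA (Set AP) Z}
    (hA : (S.spec φ').RecognizedBy A) {v : S.X → Z → ℝ} (hv : IsValue S A v)
    (κ : S.Policy) {t : ℕ} {ω : S.Traj t} (h : ¬ S.TrajSat ω (S.spec φ'))
    (hs : ∀ i, ω.1 i ∈ S.safe) (w : S.W) :
    valueAlong (S.spec φ') A v (extend κ t (ω, w)) =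
      v (S.f (ω.1 (Fin.last t)) (κ t ω) w)
        (A.step (A.eval (S.trace ω)) (S.L (S.f (ω.1 (Fin.last t)) (κ t ω) w))) := by
  have htr := trace_extend κ (ω, w)
  have hev : A.eval (S.trace (extend κ t (ω, w))) =
      A.step (A.eval (S.trace ω)) (S.L (S.f (ω.1 (Fin.last t)) (κ t ω) w)) := by
    rw [htr, DFA.eval_append_singleton]
  have hiff : S.TrajSat (extend κ t (ω, w)) (S.spec φ') ↔
      (S.spec φ').Sat (S.trace (extend κ t (ω, w))) := by
    rw [trajSat_extend_iff]
    exact or_iff_right h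
  have hacc := hA _ (trace_ne_nil (extend κ t (ω, w)))
  rw [hev] at hacc
  by_cases hsat : (S.spec φ').Sat (S.trace (extend κ t (ω, w)))
  · have hy := safe_of_sat_trace hsat (Fin.last (t + 1))
    rw [extend_last] at hy
    rw [valueAlong, if_pos (hiff.2 hsat), hv.eq_one _ hy _ (hacc.2 hsat)]
  · rw [valueAlong, if_neg (mt hiff.1 hsat)]
    by_cases hy : S.f (ω.1 (Fin.last t)) (κ t ω) w ∈ S.safe
    · rw [if_pos ((forall_extend_safe_iff κ _).2 ⟨hs, hy⟩), extend_last, hev]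
    · rw [if_neg fun h' => hy ((forall_extend_safe_iff κ _).1 h').2,
        hv.eq_zero _ hy _ (mt hacc.1 hsat)]

theorem not_mem_accept_of_not_trajSat {φ : LTLf AP} {A : DFA (Set AP) Z}
    (hA : φ.RecognizedBy A) {t : ℕ} {ω : S.Traj t} (h : ¬ S.TrajSat ω φ) :
    A.eval (S.trace ω) ∉ A.accept := fun h' =>
  h ⟨_, List.prefix_rfl, trace_ne_nil _, (hA _ (trace_ne_nil ω)).1 h'⟩

theorem prob_eq_integral_valueAlong [MeasurableSpace U] {φ : LTLf AP}
    {A : DFA (Set AP) Z} (hA : φ.RecognizedBy A) {κ : S.Policy} (x₀ : S.X) (T : ℕ) :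
    S.prob κ x₀ φ T = ∫ ω, valueAlong φ A (acceptValue S A) ω ∂(S.trajMeasure κ x₀ T) := by
  have h1 : MeasurableSet {ω : S.Traj T | S.TrajSat ω φ} :=
    measurableSet_trace fun l => ∃ l', l' <+: l ∧ l' ≠ [] ∧ φ.Sat l'
  have h2 : (fun ω : S.Traj T => valueAlong φ A (acceptValue S A) ω) =
      {ω : S.Traj T | S.TrajSat ω φ}.indicator 1 := by
    funext ω
    by_cases h : S.TrajSat ω φ
    · rw [indicator_of_mem (by exact h), valueAlong, if_pos h]
      rfl
    · rw [indicator_of_notMem (by exact h), valueAlong, if_neg h]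
      simp [acceptValue, not_mem_accept_of_not_trajSat hA h]
  rw [h2, integral_indicator_one h1]
  rfl

theorem integral_valueAlong_zero [MeasurableSpace U] [Finite Z] {φ' : LTLf AP} {A : DFA (Set AP) Z}
    (hA : (S.spec φ').RecognizedBy A) {v : S.X → Z → ℝ} (hv : IsValue S A v)
    (κ : S.Policy) (x₀ : S.X) :
    ∫ ω, valueAlong (S.spec φ') A v ω ∂(S.trajMeasure κ x₀ 0) =
      v x₀ (A.step A.start (S.L x₀)) := by
  let ω₀ : S.Traj 0 := (fun _ => x₀, Fin.elim0)
  have h1 : S.trajMeasure κ x₀ 0 = Measure.dirac ω₀ := by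
    change Measure.map (fun _ => ω₀) _ = _
    rw [Measure.map_const, measure_univ, one_smul]
  have htr : S.trace ω₀ = [S.L x₀] := by simp [trace, ω₀]
  have hev : A.eval (S.trace ω₀) = A.step A.start (S.L x₀) := by rw [htr, DFA.eval_singleton]
  have hacc := hA _ (trace_ne_nil ω₀)
  rw [hev] at hacc
  rw [h1, integral_dirac' _ _ (measurable_valueAlong _ hv 0).stronglyMeasurable]
  by_cases h : S.TrajSat ω₀ (S.spec φ')
  · have hsat : (S.spec φ').Sat (S.trace ω₀) := by
      obtain ⟨l, hl, hne, hs⟩ := h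
      rw [htr] at hl ⊢
      rcases List.prefix_cons_iff.1 hl with rfl | ⟨l', rfl, hl'⟩
      · exact absurd rfl hne
      · rwa [List.prefix_nil.1 hl'] at hs
    rw [valueAlong, if_pos h, hv.eq_one _ (safe_of_sat_trace hsat 0) _ (hacc.2 hsat)]
  · have hna := not_mem_accept_of_not_trajSat hA h
    rw [hev] at hna
    rw [valueAlong, if_neg h]
    by_cases hx : x₀ ∈ S.safe
    · rw [if_pos fun _ => hx, hev]
    · rw [if_neg fun h' => hx (h' 0), hv.eq_zero _ hx _ hna]

section
variable [MeasurableSpace U] [DiscreteMeasurableSpace U] [Finite U] [Finite Z]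

theorem integral_valueAlong_succ {Lf : ℝ} (hlip : S.LipschitzDynamics Lf) (φ : LTLf AP)
    {A : DFA (Set AP) Z} {v : S.X → Z → ℝ} (hv : IsValue S A v) {κ : S.Policy}
    (hκ : S.IsController κ) (x₀ : S.X) (t : ℕ) :
    Integrable (fun ω => ∫ w, valueAlong φ A v (extend κ t (ω, w)) ∂S.PW) (S.trajMeasure κ x₀ t) ∧
    ∫ ω, valueAlong φ A v ω ∂(S.trajMeasure κ x₀ (t + 1)) =
      ∫ ω, ∫ w, valueAlong φ A v (extend κ t (ω, w)) ∂S.PW ∂(S.trajMeasure κ x₀ t) := by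
  have := hlip.isProbabilityMeasure_trajMeasure hκ x₀ t
  have hm := (measurable_valueAlong φ hv (t + 1)).comp (hlip.measurable_extend hκ t)
  have hint := integrable_of_mem_Icc (μ := (S.trajMeasure κ x₀ t).prod S.PW) hm
    fun p => valueAlong_mem_Icc φ hv _
  refine ⟨hint.integral_prod_left, ?_⟩
  rw [hlip.trajMeasure_succ hκ, integral_map (hlip.measurable_extend hκ t).aemeasurable
    (measurable_valueAlong φ hv (t + 1)).aestronglyMeasurable]
  exact integral_prod _ hint

/-- A supersolution of the dynamic programming equation for `κ` bounds the satisfaction probability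
from above: along trajectories it is a supermartingale. -/
theorem prob_le_of_supersolution {Lf : ℝ} (hlip : S.LipschitzDynamics Lf) {φ' : LTLf AP}
    {A : DFA (Set AP) Z} (hA : (S.spec φ').RecognizedBy A) {v : ℕ → S.X → Z → ℝ}
    (hv : ∀ k, IsValue S A (v k)) (hv0 : v 0 = acceptValue S A) {κ : S.Policy}
    (hκ : S.IsController κ) (T : ℕ)
    (hstep : ∀ t k, t + (k + 1) = T → ∀ ω : S.Traj t, ω.1 (Fin.last t) ∈ S.safe →
      A.eval (S.trace ω) ∉ A.accept →
      ∫ w, v k (S.f (ω.1 (Fin.last t)) (κ t ω) w)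
          (A.step (A.eval (S.trace ω)) (S.L (S.f (ω.1 (Fin.last t)) (κ t ω) w))) ∂S.PW ≤
        v (k + 1) (ω.1 (Fin.last t)) (A.eval (S.trace ω))) (x₀ : S.X) :
    S.prob κ x₀ (S.spec φ') T ≤ v T x₀ (A.step A.start (S.L x₀)) := by
  have key : ∀ k t, t + k = T → S.prob κ x₀ (S.spec φ') T ≤
      ∫ ω, valueAlong (S.spec φ') A (v k) ω ∂(S.trajMeasure κ x₀ t) := by
    intro k
    induction k with
    | zero =>
      rintro t rfl
      rw [prob_eq_integral_valueAlong hA, hv0]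
      rfl
    | succ k ih =>
      intro t ht
      refine (ih (t + 1) (by omega)).trans ?_
      obtain ⟨hint, heq⟩ := integral_valueAlong_succ hlip (S.spec φ') (hv k) hκ x₀ t
      have := hlip.isProbabilityMeasure_trajMeasure hκ x₀ t
      rw [heq]
      refine integral_mono hint (integrable_of_mem_Icc (measurable_valueAlong _ (hv (k + 1)) t)
        fun ω => valueAlong_mem_Icc _ (hv (k + 1)) ω) fun ω => ?_
      by_cases h : S.TrajSat ω (S.spec φ')
      · simp only [valueAlong_extend_of_trajSat A (v k) κ h]
        simp [valueAlong, h]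
      · by_cases hs : ∀ i, ω.1 i ∈ S.safe
        · simp only [valueAlong_extend_of_safe hA (hv k) κ h hs]
          rw [valueAlong, if_neg h, if_pos hs]
          exact hstep t k ht ω (hs _) (not_mem_accept_of_not_trajSat hA h)
        · simp only [valueAlong_extend_of_not_safe A (v k) κ h hs]
          rw [valueAlong, if_neg h, if_neg hs]
          simp
  exact (key T 0 (zero_add T)).trans_eq (integral_valueAlong_zero hA (hv T) κ x₀)

/-- A subsolution of the dynamic programming equation for `κ` bounds the satisfaction probability
from below: along trajectories it is a submartingale. -/
theorem le_prob_of_subsolution {Lf : ℝ} (hlip : S.LipschitzDynamics Lf) {φ' : LTLf AP}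
    {A : DFA (Set AP) Z} (hA : (S.spec φ').RecognizedBy A) {v : ℕ → S.X → Z → ℝ}
    (hv : ∀ k, IsValue S A (v k)) (hv0 : v 0 = acceptValue S A) {κ : S.Policy}
    (hκ : S.IsController κ) (T : ℕ)
    (hstep : ∀ t k, t + (k + 1) = T → ∀ ω : S.Traj t, ω.1 (Fin.last t) ∈ S.safe →
      A.eval (S.trace ω) ∉ A.accept →
      v (k + 1) (ω.1 (Fin.last t)) (A.eval (S.trace ω)) ≤
      ∫ w, v k (S.f (ω.1 (Fin.last t)) (κ t ω) w)
          (A.step (A.eval (S.trace ω)) (S.L (S.f (ω.1 (Fin.last t)) (κ t ω) w))) ∂S.PW)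
    (x₀ : S.X) :
    v T x₀ (A.step A.start (S.L x₀)) ≤ S.prob κ x₀ (S.spec φ') T := by
  have key : ∀ k t, t + k = T →
      ∫ ω, valueAlong (S.spec φ') A (v k) ω ∂(S.trajMeasure κ x₀ t) ≤
        S.prob κ x₀ (S.spec φ') T := by
    intro k
    induction k with
    | zero =>
      rintro t rfl
      rw [prob_eq_integral_valueAlong hA, hv0]
      rfl
    | succ k ih =>
      intro t ht
      refine le_trans ?_ (ih (t + 1) (by omega))
      obtain ⟨hint, heq⟩ := integral_valueAlong_succ hlip (S.spec φ') (hv k) hκ x₀ t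
      have := hlip.isProbabilityMeasure_trajMeasure hκ x₀ t
      rw [heq]
      refine integral_mono (integrable_of_mem_Icc (measurable_valueAlong _ (hv (k + 1)) t)
        fun ω => valueAlong_mem_Icc _ (hv (k + 1)) ω) hint fun ω => ?_
      by_cases h : S.TrajSat ω (S.spec φ')
      · simp only [valueAlong_extend_of_trajSat A (v k) κ h]
        simp [valueAlong, h]
      · by_cases hs : ∀ i, ω.1 i ∈ S.safe
        · simp only [valueAlong_extend_of_safe hA (hv k) κ h hs]
          rw [valueAlong, if_neg h, if_pos hs]
          exact hstep t k ht ω (hs _) (not_mem_accept_of_not_trajSat hA h)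
        · simp only [valueAlong_extend_of_not_safe A (v k) κ h hs]
          rw [valueAlong, if_neg h, if_neg hs]
          simp
  exact (integral_valueAlong_zero hA (hv T) κ x₀).symm.trans_le (key T 0 (zero_add T))

end

/-! ### Robust dynamic programming bounds satisfaction probabilities -/

namespace UMDP

variable (M : UMDP S) (A : DFA (Set AP) Z)

/-- Value functions that are constant on the cells. -/
structure IsCellValue (v : S.X → Z → ℝ) : Prop extends IsValue S A v where
  rho_eq : ∀ x ∈ S.absSet, ∀ z, v (M.rho x) z = v x z

theorem isCellValue_acceptValue : IsCellValue M A (acceptValue S A) where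
  toIsValue := isValue_acceptValue S A
  rho_eq _ _ _ := rfl

variable {M A}

theorem rho_rho {x : S.X} (hx : x ∈ S.absSet) : M.rho (M.rho x) = M.rho x :=
  M.rho_reps _ (M.rho_mem x hx)

/-- Value functions that are constant on the cells agree with their minorants on `X_abs`. -/
theorem IsCellValue.minorant_eq {v : S.X → Z → ℝ} (hv : IsCellValue M A v) {x : S.X}
    (hx : x ∈ S.absSet) (z : Z) : M.minorant v x z = v x z := by
  have : (fun y => v y z) '' {y ∈ S.absSet | M.rho y = M.rho x} = {v x z} := by
    ext r
    constructor
    · rintro ⟨y, ⟨hy, hyx⟩, rfl⟩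
      rw [mem_singleton_iff]
      dsimp only
      rw [← hv.rho_eq y hy, hyx, hv.rho_eq x hx]
    · rintro rfl
      exact ⟨x, ⟨hx, rfl⟩, rfl⟩
  rw [minorant, if_pos hx, this, csInf_singleton]

theorem IsCellValue.expect_eq {v : S.X → Z → ℝ} (hv : IsCellValue M A v) (z : Z)
    (γ : M.reps → ℝ) :
    M.expect A v z γ = ∑ s' : M.reps, γ s' * v s' (A.step z (S.L s')) :=
  Finset.sum_congr rfl fun s' _ => by rw [hv.minorant_eq (M.reps_subset _ s'.2)]

theorem IsCellValue.expect_mem_Icc {v : S.X → Z → ℝ} (hv : IsCellValue M A v) (z : Z)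
    {γ : M.reps → ℝ} (hγ : γ ∈ stdSimplex ℝ M.reps) : M.expect A v z γ ∈ Icc (0 : ℝ) 1 := by
  rw [hv.expect_eq]
  refine ⟨Finset.sum_nonneg fun s' _ => mul_nonneg (hγ.1 s') (hv.mem_Icc _ _).1, ?_⟩
  rw [← hγ.2]
  exact Finset.sum_le_sum fun s' _ => mul_le_of_le_one_right (hγ.1 s') (hv.mem_Icc _ _).2

/-- Under the discretized kernel, the expectation is the one under the true kernel. -/
theorem IsCellValue.expect_trans {v : S.X → Z → ℝ} (hv : IsCellValue M A v) (z : Z)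
    {x : S.X} (hx : x ∈ S.safe) {a : U} (hm : Measurable (S.f x a)) :
    M.expect A v z (fun s' : M.reps => (S.trans x a).real (M.cell s')) =
      ∫ w, v (S.f x a w) (A.step z (S.L (S.f x a w))) ∂S.PW := by
  rw [hv.expect_eq, M.sum_cell_mul_eq_integral hx hm fun s => v s (A.step z (S.L s))]
  refine integral_congr_ae (Eventually.of_forall fun w => ?_)
  have hy := f_mem_absSet hx a w
  simp only [M.L_rho hy, hv.rho_eq _ hy]

theorem expect_image_subset (hM : M.WellFormed) {v : S.X → Z → ℝ} (hv : IsCellValue M A v) {s : S.X}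
    (hs : s ∈ M.reps) (a : U) (z : Z) : M.expect A v z '' M.Γ s a ⊆ Icc 0 1 := by
  rintro _ ⟨γ, hγ, rfl⟩
  exact hv.expect_mem_Icc z ((hM s hs a).2.2 hγ)

theorem bddBelow_expect (hM : M.WellFormed) {v : S.X → Z → ℝ} (hv : IsCellValue M A v) {s : S.X}
    (hs : s ∈ M.reps) (a : U) (z : Z) : BddBelow (M.expect A v z '' M.Γ s a) :=
  bddBelow_Icc.mono (expect_image_subset hM hv hs a z)

theorem bddAbove_expect (hM : M.WellFormed) {v : S.X → Z → ℝ} (hv : IsCellValue M A v) {s : S.X}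
    (hs : s ∈ M.reps) (a : U) (z : Z) : BddAbove (M.expect A v z '' M.Γ s a) :=
  bddAbove_Icc.mono (expect_image_subset hM hv hs a z)

theorem bellmanLow_mem_Icc (hM : M.WellFormed) {v : S.X → Z → ℝ} (hv : IsCellValue M A v) {x : S.X}
    (hx : x ∈ S.absSet) (a : U) (z : Z) : M.bellmanLow A a v x z ∈ Icc (0 : ℝ) 1 := by
  unfold bellmanLow
  split_ifs
  · simp
  · have hs := M.rho_mem x hx
    have hsub := expect_image_subset hM hv hs a z
    obtain ⟨y, hy⟩ := (hM _ hs a).1.image (M.expect A v z)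
    exact ⟨le_csInf ⟨y, hy⟩ fun r hr => (hsub hr).1,
      (csInf_le (bddBelow_expect hM hv hs a z) hy).trans (hsub hy).2⟩

theorem bellmanUp_mem_Icc (hM : M.WellFormed) {v : S.X → Z → ℝ} (hv : IsCellValue M A v) {x : S.X}
    (hx : x ∈ S.absSet) (a : U) (z : Z) : M.bellmanUp A a v x z ∈ Icc (0 : ℝ) 1 := by
  unfold bellmanUp
  split_ifs
  · simp
  · have hs := M.rho_mem x hx
    have hsub := expect_image_subset hM hv hs a z
    obtain ⟨y, hy⟩ := (hM _ hs a).1.image (M.expect A v z)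
    exact ⟨(hsub hy).1.trans (le_csSup (bddAbove_expect hM hv hs a z) hy),
      csSup_le ⟨y, hy⟩ fun r hr => (hsub hr).2⟩

theorem bellmanLow_rho {x : S.X} (hx : x ∈ S.absSet) (a : U) (v : S.X → Z → ℝ) (z : Z) :
    M.bellmanLow A a v (M.rho x) z = M.bellmanLow A a v x z := by
  rw [bellmanLow, bellmanLow, rho_rho hx]

theorem bellmanUp_rho {x : S.X} (hx : x ∈ S.absSet) (a : U) (v : S.X → Z → ℝ) (z : Z) :
    M.bellmanUp A a v (M.rho x) z = M.bellmanUp A a v x z := by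
  rw [bellmanUp, bellmanUp, rho_rho hx]

/-- On the safe set, a function that is constant on the cells is a finite sum of multiples of
indicator functions of measurable sets. -/
theorem measurable_of_rho_eq {g : S.X → ℝ} (hg : ∀ x ∈ S.absSet, g (M.rho x) = g x) :
    Measurable fun x => if x ∈ S.safe then g x else 0 := by
  have : (fun x => if x ∈ S.safe then g x else 0) = fun x =>
      ∑ s : M.reps, (S.safe ∩ M.cell s).indicator (fun _ => g s) x := by
    funext x
    split_ifs with hx
    · have hxa : x ∈ S.absSet := Or.inl hx
      rw [Finset.sum_eq_single ⟨M.rho x, M.rho_mem x hxa⟩]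
      · rw [indicator_of_mem (show x ∈ S.safe ∩ M.cell (M.rho x) from ⟨hx, M.mem_cell_rho hxa⟩),
          hg x hxa]
      · intro s _ hs
        exact indicator_of_notMem (fun h => hs (Subtype.ext h.2.2.symm)) _
      · simp
    · exact (Finset.sum_eq_zero fun s _ => indicator_of_notMem (fun h => hx h.1) _).symm
  rw [this]
  exact Finset.measurable_sum _ fun s _ =>
    measurable_const.indicator (S.measurableSet_safe.inter (M.measurableSet_cell' s.2))

theorem iSup_mem_Icc_of_forall [Finite U] [Nonempty U] {b : U → ℝ}
    (hb : ∀ a, b a ∈ Icc (0 : ℝ) 1) : ⨆ a, b a ∈ Icc (0 : ℝ) 1 :=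
  ⟨Real.iSup_nonneg fun a => (hb a).1, ciSup_le fun a => (hb a).2⟩

/-- Maximizing cellwise constant quantities over the actions gives a cellwise constant value
function. -/
theorem isCellValue_iSup [Finite U] [Nonempty U] {b : U → S.X → Z → ℝ}
    (hb : ∀ a, ∀ x ∈ S.absSet, ∀ z, b a x z ∈ Icc (0 : ℝ) 1)
    (hrho : ∀ a, ∀ x ∈ S.absSet, ∀ z, b a (M.rho x) z = b a x z)
    (hacc : ∀ a x, ∀ z ∈ A.accept, b a x z = 1) :
    IsCellValue M A fun x z => if x ∈ S.safe then ⨆ a, b a x z else 0 where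
  measurable z := measurable_of_rho_eq (M := M) (g := fun x => ⨆ a, b a x z) fun x hx => by
    simp only [hrho _ x hx]
  mem_Icc x z := by
    split_ifs with hx
    · exact iSup_mem_Icc_of_forall fun a => hb a x (Or.inl hx) z
    · simp
  eq_one x hx z hz := by
    rw [if_pos hx]
    simp only [hacc _ x z hz, ciSup_const]
  eq_zero x hx z _ := if_neg hx
  rho_eq x hx z := by
    simp only [M.rho_mem_safe_iff hx, hrho _ x hx]

theorem vLow_succ_of_mem_safe {x : S.X} (hx : x ∈ S.safe) (k : ℕ) (z : Z) :
    M.vLow A (k + 1) x z = ⨆ a, M.bellmanLow A a (M.vLow A k) x z := if_pos hx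

theorem vUp_succ_of_mem_safe {x : S.X} (hx : x ∈ S.safe) (k : ℕ) (z : Z) :
    M.vUp A (k + 1) x z = ⨆ a, M.bellmanUp A a (M.vUp A k) x z := if_pos hx

theorem isCellValue_vLow [Finite U] [Nonempty U] (hM : M.WellFormed) (k : ℕ) :
    IsCellValue M A (M.vLow A k) := by
  induction k with
  | zero => exact isCellValue_acceptValue M A
  | succ k ih =>
    exact isCellValue_iSup (fun a x hx z => bellmanLow_mem_Icc hM ih hx a z)
      (fun a x hx z => bellmanLow_rho hx a _ z) fun a x z hz => if_pos hz

theorem isCellValue_vUp [Finite U] [Nonempty U] (hM : M.WellFormed) (k : ℕ) :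
    IsCellValue M A (M.vUp A k) := by
  induction k with
  | zero => exact isCellValue_acceptValue M A
  | succ k ih =>
    exact isCellValue_iSup (fun a x hx z => bellmanUp_mem_Icc hM ih hx a z)
      (fun a x hx z => bellmanUp_rho hx a _ z) fun a x z hz => if_pos hz

theorem isController_refine [MeasurableSpace U] [Nonempty U] (σ : Strategy U S Z) :
    S.IsController (M.refine A σ) := by
  intro t B _
  have hlast : Measurable fun ω : S.Traj t => ω.1 (Fin.last t) := by fun_prop
  have : M.refine A σ t ⁻¹' B =
      (⋃ s : M.reps, {ω : S.Traj t | ω.1 (Fin.last t) ∈ M.cell s} ∩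
        {ω | σ t s (A.eval (S.trace ω)) ∈ B}) ∪
      ({ω : S.Traj t | ω.1 (Fin.last t) ∈ S.absSet}ᶜ ∩
        {_ω | Classical.arbitrary U ∈ B}) := by
    ext ω
    simp only [mem_preimage, refine, mem_union, mem_iUnion, mem_inter_iff, mem_ofPred_eq,
      mem_compl_iff]
    by_cases h : ω.1 (Fin.last t) ∈ S.absSet
    · simp only [h, if_true, not_true, false_and, or_false]
      constructor
      · exact fun hB => ⟨⟨_, M.rho_mem _ h⟩, M.mem_cell_rho h, hB⟩
      · rintro ⟨s, hs, hB⟩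
        rwa [hs.2]
    · simp only [h, if_false, not_false_eq_true, true_and]
      constructor
      · exact Or.inr
      · rintro (⟨s, hs, -⟩ | hB)
        · exact absurd hs.1 h
        · exact hB
  rw [this]
  refine MeasurableSet.union (MeasurableSet.iUnion fun s => ?_) ?_
  · exact (hlast (M.measurableSet_cell' s.2)).inter
      (measurableSet_trace fun l => σ t s (A.eval l) ∈ B)
  · exact (hlast M.measurableSet_absSet).compl.inter (MeasurableSet.const _)

theorem bddAbove_prob [MeasurableSpace U] [DiscreteMeasurableSpace U] [Finite U] {Lf : ℝ}
    (hlip : S.LipschitzDynamics Lf) (x₀ : S.X) (φ : LTLf AP) (T : ℕ) :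
    BddAbove (range fun κ : {κ : S.Policy // S.IsController κ} => S.prob κ.1 x₀ φ T) := by
  refine ⟨1, ?_⟩
  rintro _ ⟨κ, rfl⟩
  have := hlip.isProbabilityMeasure_trajMeasure κ.2 x₀ T
  exact measureReal_le_one

theorem prob_refine_le_optProb [MeasurableSpace U] [DiscreteMeasurableSpace U] [Finite U]
    [Nonempty U] {Lf : ℝ} (hlip : S.LipschitzDynamics Lf) (σ : Strategy U S Z) (φ : LTLf AP)
    (T : ℕ) (x₀ : S.X) : S.prob (M.refine A σ) x₀ φ T ≤ S.optProb x₀ φ T :=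
  le_ciSup (bddAbove_prob hlip x₀ φ T) ⟨_, isController_refine σ⟩

section
variable [MeasurableSpace U] [DiscreteMeasurableSpace U] [Finite U] [Nonempty U] [Finite Z]
  {Lf : ℝ} {φ' : LTLf AP}

/-- The optimistic values dominate every controller, as the true kernel is among the choices of the
optimistic adversary. -/
theorem prob_le_pUp (hlip : S.LipschitzDynamics Lf) (hM : M.WellFormed) (hS : M.Sound)
    (hA : (S.spec φ').RecognizedBy A) {κ : S.Policy} (hκ : S.IsController κ) (T : ℕ) (x₀ : S.X) :
    S.prob κ x₀ (S.spec φ') T ≤ M.pUp A T x₀ := by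
  refine prob_le_of_supersolution hlip hA (v := M.vUp A)
    (fun k => (isCellValue_vUp hM k).toIsValue) rfl hκ T (fun t k _ ω hx hz => ?_) x₀
  have hv := isCellValue_vUp (A := A) hM k
  rw [← hv.expect_trans _ hx (hlip.measurable _ _), vUp_succ_of_mem_safe hx]
  refine le_trans ?_ (le_ciSup (Set.finite_range _).bddAbove (κ t ω))
  rw [bellmanUp, if_neg hz]
  exact le_csSup (bddAbove_expect hM hv (M.rho_mem _ (Or.inl hx)) _ _)
    (mem_image_of_mem _ (hS.1 _ hx _))

/-- The pessimistic values are guaranteed by the strategy that maximizes them, as the true kernel is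
among the choices of the pessimistic adversary. -/
theorem pLow_le_prob (hlip : S.LipschitzDynamics Lf) (hM : M.WellFormed) (hS : M.Sound)
    (hA : (S.spec φ').RecognizedBy A) {T : ℕ} {σ : Strategy U S Z} (hσ : M.IsRDPStrategy A T σ)
    (x₀ : S.X) : M.pLow A T x₀ ≤ S.prob (M.refine A σ) x₀ (S.spec φ') T := by
  refine le_prob_of_subsolution hlip hA (v := M.vLow A)
    (fun k => (isCellValue_vLow hM k).toIsValue) rfl (isController_refine σ) T
    (fun t k htk ω hx hz => ?_) x₀
  have hv := isCellValue_vLow (A := A) hM k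
  have hxa : ω.1 (Fin.last t) ∈ S.absSet := Or.inl hx
  have hκ : M.refine A σ t ω = σ t (M.rho (ω.1 (Fin.last t))) (A.eval (S.trace ω)) := if_pos hxa
  rw [← hv.expect_trans _ hx (hlip.measurable _ _), vLow_succ_of_mem_safe hx, hκ]
  refine ciSup_le fun a => ?_
  have h := hσ t (by omega) _ (M.rho_mem _ hxa) (A.eval (S.trace ω)) a
  rw [show T - t - 1 = k by omega, bellmanLow_rho hxa, bellmanLow_rho hxa] at h
  refine h.trans ?_
  rw [bellmanLow, if_neg hz]
  exact csInf_le (bddBelow_expect hM hv (M.rho_mem _ hxa) _ _)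
    (mem_image_of_mem _ (hS.1 _ hx _))

theorem optProb_le_pUp (hlip : S.LipschitzDynamics Lf) (hM : M.WellFormed) (hS : M.Sound)
    (hA : (S.spec φ').RecognizedBy A) (T : ℕ) (x₀ : S.X) :
    S.optProb x₀ (S.spec φ') T ≤ M.pUp A T x₀ := by
  have : Nonempty {κ : S.Policy // S.IsController κ} :=
    ⟨⟨fun _ _ => Classical.arbitrary U, fun _ => measurable_const⟩⟩
  exact ciSup_le fun κ => prob_le_pUp hlip hM hS hA κ.2 T x₀

/-- Whenever the gap between the bounds is at most `ε`, the output of robust dynamic programming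
solves the control problem. -/
theorem solves_of_gap_le (hlip : S.LipschitzDynamics Lf) (hM : M.WellFormed) (hS : M.Sound)
    (hA : (S.spec φ').RecognizedBy A) {T : ℕ} {σ : Strategy U S Z} (hσ : M.IsRDPStrategy A T σ)
    {ε : ℝ} (hgap : ∀ x, M.pUp A T x - M.pLow A T x ≤ ε) :
    S.Solves (S.spec φ') T ε (M.refine A σ) (M.pLow A T) (M.pUp A T) := by
  refine ⟨isController_refine σ, fun x => ?_⟩
  have h1 := pLow_le_prob hlip hM hS hA hσ x
  have h2 := prob_refine_le_optProb (M := M) (A := A) hlip σ (S.spec φ') T x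
  have h3 := optProb_le_pUp hlip hM hS hA T x
  have h4 := hgap x
  refine ⟨?_, ⟨h1, h2.trans h3⟩, h4⟩
  rw [abs_le]
  constructor <;> linarith

end

end UMDP

end StochSystem

namespace StochSystem

variable {n d : ℕ} {U AP : Type} {S : StochSystem n d U AP}

/-! ### Successor laws and Lebesgue measure -/

theorem isCompact_absSet [Finite U] {Lf : ℝ} (hlip : S.LipschitzDynamics Lf)
    (hsafe : IsCompact S.safe) : IsCompact S.absSet := by
  have h : S.absSet = S.safe ∪ ⋃ a : U, (fun p : S.X × S.W => S.f p.1 a p.2) ''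
      (S.safe ×ˢ univ) := by
    ext y
    simp only [absSet, mem_union, mem_ofPred_eq, mem_iUnion, mem_image, mem_prod, mem_univ,
      and_true, Prod.exists]
    refine or_congr Iff.rfl ⟨?_, ?_⟩
    · rintro ⟨x, hx, a, w, rfl⟩
      exact ⟨a, x, w, hx, rfl⟩
    · rintro ⟨a, x, w, hx, rfl⟩
      exact ⟨x, hx, a, w, rfl⟩
  rw [h]
  exact hsafe.union
    (isCompact_iUnion fun a => (hsafe.prod isCompact_univ).image (hlip.continuous a))

theorem lebesgue_lt_top_of_isCompact {K : Set S.X} (hK : IsCompact K) : S.lebesgue K < ∞ := by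
  rw [lebesgue, (MeasurableEmbedding.subtype_coe S.measurableSet_X).comap_apply]
  exact (hK.image continuous_subtype_val).measure_lt_top

/-- The points on the boundaries of the regions. -/
def boundarySet (S : StochSystem n d U AP) : Set S.X := ⋃ i, frontier (S.region i)

theorem CompactSafeNullBoundary.lebesgue_boundarySet (h : S.CompactSafeNullBoundary) :
    S.lebesgue S.boundarySet = 0 :=
  measure_iUnion_null h.2

theorem BoundedDensity.trans_absolutelyContinuous (h : S.BoundedDensity) (x : S.X) (a : U) :
    S.trans x a ≪ S.lebesgue := by
  obtain ⟨τ, _, _, _, _, hτ⟩ := h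
  rw [hτ]
  exact withDensity_absolutelyContinuous _ _

theorem BoundedDensity.exists_trans_le (h : S.BoundedDensity) :
    ∃ τmax < ∞, ∀ x a B, MeasurableSet B → S.trans x a B ≤ τmax * S.lebesgue B := by
  obtain ⟨τ, τmax, hlt, _, hle, hτ⟩ := h
  refine ⟨τmax, hlt, fun x a B hB => ?_⟩
  rw [hτ, withDensity_apply _ hB, ← setLIntegral_const]
  exact lintegral_mono fun y => hle x a y

theorem region_mem_nhds {x : S.X} (hx : x ∉ S.boundarySet) {i : Fin (S.m + 1)}
    (hi : x ∈ S.region i) : S.region i ∈ 𝓝 x := by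
  rw [← mem_interior_iff_mem_nhds]
  by_contra h
  exact hx (mem_iUnion.2 ⟨i, subset_closure hi, h⟩)

theorem eventually_L_eq {x : S.X} (hx : x ∉ S.boundarySet) : ∀ᶠ y in 𝓝 x, S.L y = S.L x := by
  obtain ⟨i, hi⟩ := S.exists_mem_region x
  filter_upwards [region_mem_nhds hx hi] with y hy
  exact S.L_const i y hy x hi

theorem eventually_mem_safe_iff {x : S.X} (hx : x ∉ S.boundarySet) :
    ∀ᶠ y in 𝓝 x, (y ∈ S.safe ↔ x ∈ S.safe) := by
  filter_upwards [eventually_L_eq hx] with y hy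
  rw [← S.pSafe_mem, ← S.pSafe_mem, hy]

/-! ### The exact value functions -/

variable {Z : Type} (A : DFA (Set AP) Z)

/-- The value functions of exact dynamic programming on the product with the automaton. -/
def exactValue (S : StochSystem n d U AP) (A : DFA (Set AP) Z) : ℕ → S.X → Z → ℝ
  | 0 => acceptValue S A
  | k + 1 => fun x z =>
    if x ∈ S.safe then
      if z ∈ A.accept then 1
      else ⨆ a, ∫ w, exactValue S A k (S.f x a w) (A.step z (S.L (S.f x a w))) ∂S.PW
    else 0

theorem exactValue_succ {x : S.X} (hx : x ∈ S.safe) {z : Z} (hz : z ∉ A.accept) (k : ℕ) :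
    exactValue S A (k + 1) x z =
      ⨆ a, ∫ w, exactValue S A k (S.f x a w) (A.step z (S.L (S.f x a w))) ∂S.PW :=
  (if_pos hx).trans (if_neg hz)

theorem integral_mem_Icc {g : S.X → ℝ} (h : ∀ y, g y ∈ Icc (0 : ℝ) 1) (x : S.X) (a : U) :
    ∫ w, g (S.f x a w) ∂S.PW ∈ Icc (0 : ℝ) 1 := by
  refine ⟨integral_nonneg fun w => (h _).1, ?_⟩
  have h1 := norm_integral_le_of_norm_le_const (μ := S.PW) (f := fun w => g (S.f x a w)) (C := 1)
    (Eventually.of_forall fun w => by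
      rw [Real.norm_eq_abs, abs_of_nonneg (h _).1]
      exact (h _).2)
  rw [probReal_univ, mul_one] at h1
  exact (le_abs_self _).trans h1

/-- Averaging over the disturbance smooths: discontinuities on a null set are not seen by the
absolutely continuous successor law. -/
theorem continuousAt_integral {Lf : ℝ} (hlip : S.LipschitzDynamics Lf) (hdens : S.BoundedDensity)
    (hnull : S.lebesgue S.boundarySet = 0) {g : S.X → ℝ} (hg : Measurable g)
    (h01 : ∀ y, g y ∈ Icc (0 : ℝ) 1) (hc : ∀ y ∉ S.boundarySet, ContinuousAt g y) (x : S.X)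
    (a : U) : ContinuousAt (fun x => ∫ w, g (S.f x a w) ∂S.PW) x := by
  refine continuousAt_of_dominated (bound := fun _ => 1)
    (Eventually.of_forall fun x => (hg.comp (hlip.measurable x a)).aestronglyMeasurable)
    (Eventually.of_forall fun x => Eventually.of_forall fun w => ?_) (integrable_const _) ?_
  · rw [Real.norm_eq_abs, abs_of_nonneg (h01 _).1]
    exact (h01 _).2
  · have h : ∀ᵐ y ∂S.trans x a, y ∉ S.boundarySet :=
      measure_eq_zero_iff_ae_notMem.1 (hdens.trans_absolutelyContinuous x a hnull)
    filter_upwards [ae_of_ae_map (hlip.measurable x a).aemeasurable h] with w hw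
    have hf : Continuous fun x => S.f x a w :=
      (hlip.continuous a).comp (by fun_prop : Continuous fun x : S.X => (x, w))
    exact (hc _ hw).comp (f := fun x => S.f x a w) hf.continuousAt

theorem continuousAt_stepValue {v : S.X → Z → ℝ}
    (hv : ∀ z, ∀ x ∉ S.boundarySet, ContinuousAt (fun x => v x z) x) (z : Z) {x : S.X}
    (hx : x ∉ S.boundarySet) : ContinuousAt (fun y => v y (A.step z (S.L y))) x := by
  refine (hv (A.step z (S.L x)) x hx).congr ?_
  filter_upwards [eventually_L_eq hx] with y hy
  rw [hy]

section
variable [Finite U] [Nonempty U] [Finite Z] {Lf : ℝ}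

theorem isValue_exactValue (hlip : S.LipschitzDynamics Lf) (k : ℕ) :
    IsValue S A (exactValue S A k) := by
  induction k with
  | zero => exact isValue_acceptValue S A
  | succ k ih =>
    refine ⟨fun z => ?_, fun x z => ?_, fun x hx z hz => ?_, fun x hx z _ => if_neg hx⟩
    · refine Measurable.ite S.measurableSet_safe ?_ measurable_const
      split_ifs
      · exact measurable_const
      · refine Measurable.iSup fun a => ?_
        have h : Measurable fun p : S.X × S.W =>
            exactValue S A k (S.f p.1 a p.2) (A.step z (S.L (S.f p.1 a p.2))) :=
          (measurable_stepValue A ih.measurable z).comp (hlip.continuous a).measurable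
        exact h.stronglyMeasurable.integral_prod_right.measurable
    · unfold exactValue
      split_ifs
      · simp
      · exact UMDP.iSup_mem_Icc_of_forall fun a => integral_mem_Icc
          (g := fun y => exactValue S A k y (A.step z (S.L y))) (fun y => ih.mem_Icc _ _) x a
      · simp
    · unfold exactValue
      rw [if_pos hx, if_pos hz]

theorem continuousAt_exactValue (hlip : S.LipschitzDynamics Lf) (hdens : S.BoundedDensity)
    (hnull : S.lebesgue S.boundarySet = 0) (k : ℕ) (z : Z) {x : S.X} (hx : x ∉ S.boundarySet) :
    ContinuousAt (fun x => exactValue S A k x z) x := by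
  induction k generalizing z x with
  | zero => exact continuousAt_const
  | succ k ih =>
    have hsafe := eventually_mem_safe_iff hx
    by_cases hxs : x ∈ S.safe
    · by_cases hz : z ∈ A.accept
      · refine (continuousAt_const (y := (1 : ℝ))).congr ?_
        filter_upwards [hsafe] with y hy
        exact ((isValue_exactValue A hlip (k + 1)).eq_one y (hy.2 hxs) z hz).symm
      · have hcont : ∀ a : U, ContinuousAt (fun x => ∫ w, exactValue S A k (S.f x a w)
            (A.step z (S.L (S.f x a w))) ∂S.PW) x := fun a =>
          continuousAt_integral hlip hdens hnull
            (g := fun y => exactValue S A k y (A.step z (S.L y)))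
            (measurable_stepValue A (isValue_exactValue A hlip k).measurable z)
            (fun y => (isValue_exactValue A hlip k).mem_Icc _ _)
            (fun y hy => continuousAt_stepValue A (fun z x hx => ih z hx) z hy) x a
        have := Fintype.ofFinite U
        refine (ContinuousAt.finset_sup'_apply Finset.univ_nonempty fun a _ => hcont a).congr ?_
        filter_upwards [hsafe] with y hy
        rw [Finset.sup'_univ_eq_ciSup, exactValue_succ A (hy.2 hxs) hz]
    · refine (continuousAt_const (y := (0 : ℝ))).congr ?_
      filter_upwards [hsafe] with y hy
      exact (if_neg (mt hy.1 hxs)).symm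

end

/-! ### Uniform approximation of integrals by the ambiguity sets -/

/-- The points within `δ` of which the function `g` oscillates by at least `ε`. -/
def oscSet (g : S.X → ℝ) (δ ε : ℝ) : Set S.X :=
  {y | ∃ y' y'', dist y' y < δ ∧ dist y'' y < δ ∧ ε ≤ |g y' - g y''|}

theorem isOpen_oscSet (g : S.X → ℝ) (δ ε : ℝ) : IsOpen (oscSet g δ ε) := by
  have : oscSet g δ ε = ⋃ y', ⋃ y'', ⋃ _ : ε ≤ |g y' - g y''|,
      Metric.ball y' δ ∩ Metric.ball y'' δ := by
    ext y
    simp only [oscSet, mem_ofPred_eq, mem_iUnion, mem_inter_iff, Metric.mem_ball, dist_comm y]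
    exact exists_congr fun y' => exists_congr fun y'' => by tauto
  rw [this]
  exact isOpen_iUnion fun _ => isOpen_iUnion fun _ => isOpen_iUnion fun _ =>
    Metric.isOpen_ball.inter Metric.isOpen_ball

theorem notMem_oscSet_of_continuousAt {g : S.X → ℝ} {y : S.X} (h : ContinuousAt g y) {ε : ℝ}
    (hε : 0 < ε) : ∃ δ > 0, y ∉ oscSet g δ ε := by
  obtain ⟨δ, hδ, hy⟩ := Metric.continuousAt_iff.1 h (ε / 2) (half_pos hε)
  refine ⟨δ, hδ, ?_⟩
  rintro ⟨y', y'', h', h'', hle⟩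
  have h1 := hy h'
  have h2 := hy h''
  have h3 := dist_triangle_right (g y') (g y'') (g y)
  rw [Real.dist_eq (g y')] at h3
  linarith

theorem oscSet_mono (g : S.X → ℝ) {δ δ' : ℝ} (h : δ ≤ δ') (ε : ℝ) :
    oscSet g δ ε ⊆ oscSet g δ' ε := fun _ ⟨y', y'', h1, h2, h3⟩ =>
  ⟨y', y'', h1.trans_le h, h2.trans_le h, h3⟩

/-- Uniformly in the state and the action, the successor of a safe state is unlikely to be close to
a place where an almost everywhere continuous function oscillates. -/
theorem exists_trans_oscSet_le [Finite U] {Lf : ℝ} (hlip : S.LipschitzDynamics Lf)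
    (hdens : S.BoundedDensity) (hsafe : S.CompactSafeNullBoundary) {g : S.X → ℝ}
    (hc : ∀ y ∉ S.boundarySet, ContinuousAt g y) {ε : ℝ} (hε : 0 < ε) :
    ∃ δ > 0, ∀ x ∈ S.safe, ∀ a, (S.trans x a).real (oscSet g δ ε) ≤ ε := by
  obtain ⟨τmax, hτ, hle⟩ := hdens.exists_trans_le
  have hK := isCompact_absSet hlip hsafe.1
  let δ : ℕ → ℝ := fun m => 1 / ((m : ℝ) + 1)
  let O : ℕ → Set S.X := fun m => oscSet g (δ m) ε ∩ S.absSet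
  have hOm : ∀ m, MeasurableSet (O m) := fun m =>
    (isOpen_oscSet g _ ε).measurableSet.inter hK.measurableSet
  have hanti : Antitone O := fun m m' hmm =>
    inter_subset_inter_left _ (oscSet_mono g (Nat.one_div_le_one_div hmm) ε)
  have hinter : ⋂ m, O m ⊆ S.boundarySet := by
    intro y hy
    by_contra hyN
    obtain ⟨δ', hδ', hn⟩ := notMem_oscSet_of_continuousAt (hc y hyN) hε
    obtain ⟨m, hm⟩ := exists_nat_one_div_lt hδ'
    exact hn (oscSet_mono g hm.le ε (mem_iInter.1 hy m).1)
  have hlim := tendsto_measure_iInter_atTop (μ := S.lebesgue) (s := O)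
    (fun m => (hOm m).nullMeasurableSet) hanti
    ⟨0, ((measure_mono inter_subset_right).trans_lt (lebesgue_lt_top_of_isCompact hK)).ne⟩
  rw [measure_mono_null hinter hsafe.lebesgue_boundarySet] at hlim
  have hlim' := ENNReal.Tendsto.const_mul (a := τmax) hlim (Or.inr hτ.ne)
  rw [mul_zero] at hlim'
  obtain ⟨m, hm⟩ := (hlim'.eventually_lt_const (ENNReal.ofReal_pos.2 hε)).exists
  refine ⟨δ m, Nat.one_div_pos_of_nat, fun x hx a => ?_⟩
  have hmeas : MeasurableSet (oscSet g (δ m) ε) := (isOpen_oscSet g _ ε).measurableSet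
  -- the successor law of a safe state is concentrated on `X_abs`, which has finite measure
  have hsub : S.trans x a (oscSet g (δ m) ε) = S.trans x a (O m) := by
    rw [trans, Measure.map_apply (hlip.measurable x a) hmeas,
      Measure.map_apply (hlip.measurable x a) (hOm m)]
    exact congrArg _ (inter_eq_left.2 fun w _ => f_mem_absSet hx a w).symm
  refine ENNReal.toReal_le_of_le_ofReal hε.le ?_
  rw [hsub]
  exact (hle x a _ (hOm m)).trans hm.le

/-- The distributions of the ambiguity set move the successor `f (x, a, w)` by at most a multiple of
the size of the partitions. Hence they integrate an almost everywhere continuous function as the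
true kernel does, up to an error that is small uniformly in the state, the action and the element
of the ambiguity set. -/
theorem eventually_abs_sum_sub_integral_le [Finite U] {Lf : ℝ} (hlip : S.LipschitzDynamics Lf)
    (hdens : S.BoundedDensity) (hsafe : S.CompactSafeNullBoundary) {D : ℝ → Discretization S}
    (hD : ∀ η > 0, (D η).SizeLE η) {g : S.X → ℝ} (hg : Measurable g)
    (h01 : ∀ y, g y ∈ Icc (0 : ℝ) 1) (hc : ∀ y ∉ S.boundarySet, ContinuousAt g y) {ε : ℝ}
    (hε : 0 < ε) :
    ∀ᶠ η in 𝓝[>] 0, ∀ x ∈ S.safe, ∀ a, ∀ γ ∈ (smdp (D η)).Γ ((D η).rho x) a,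
      |∑ s' : (smdp (D η)).reps, γ s' * g s' - ∫ w, g (S.f x a w) ∂S.PW| ≤ ε := by
  obtain ⟨δ, hδ, hosc⟩ := exists_trans_oscSet_le hlip hdens hsafe hc (half_pos hε)
  have hsmall : ∀ᶠ η : ℝ in 𝓝[>] 0, (4 * Lf + 2) * η < δ := by
    have h : Tendsto (fun η : ℝ => (4 * Lf + 2) * η) (𝓝 0) (𝓝 0) := by
      have h' : Continuous fun η : ℝ => (4 * Lf + 2) * η := by fun_prop
      simpa using h'.tendsto 0
    exact (h.mono_left nhdsWithin_le_nhds).eventually_lt_const hδ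
  filter_upwards [hsmall, self_mem_nhdsWithin] with η hηδ hη x hx a γ hγ
  set E := D η with hE
  have hsize : E.SizeLE η := hD η hη
  have hxa : x ∈ S.absSet := Or.inl hx
  have hs := E.rho_mem x hxa
  rw [smdp_Γ_of_mem_safe E ((E.rho_mem_safe_iff hxa).2 hx)] at hγ
  obtain ⟨θ, hθ, rfl⟩ := hγ
  have hm := hlip.measurable x a
  have hint : Integrable (fun w => g (S.f x a w)) S.PW :=
    integrable_of_mem_Icc (hg.comp hm) fun w => h01 _
  let bad : Set S.W := S.f x a ⁻¹' oscSet g δ (ε / 2)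
  have hbad : MeasurableSet bad := hm (isOpen_oscSet g δ (ε / 2)).measurableSet
  have hind : Integrable (bad.indicator (1 : S.W → ℝ)) S.PW :=
    (integrable_const (1 : ℝ)).indicator hbad
  have hbound : Integrable (fun w => ε / 2 + bad.indicator 1 w) S.PW :=
    (integrable_const _).add hind
  have hclose : ∀ c ∈ E.C, ∀ w ∈ c, ∀ q ∈ E.cluster (E.rho x) a c,
      |g q - g (S.f x a w)| ≤ ε / 2 + bad.indicator 1 w := by
    rintro c hcC w hw q ⟨y, hyq, hyr⟩
    have hd1 := dist_reach_le hlip hsize hs hcC hyr ⟨x, E.mem_cell_rho hxa, w, hw, rfl⟩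
    have hd2 := hsize.1 q q.2 q (E.self_mem_cell q.2) y hyq
    have hd : dist (q : S.X) (S.f x a w) < δ := by
      have := dist_triangle (q : S.X) y (S.f x a w)
      linarith
    -- close to a large oscillation only the trivial bound `1` is available
    by_cases hwb : w ∈ bad
    · rw [indicator_of_mem hwb, Pi.one_apply, abs_le]
      have := h01 q
      have := h01 (S.f x a w)
      simp only [mem_Icc] at *
      constructor <;> linarith
    · rw [indicator_of_notMem hwb, add_zero]
      by_contra hlt
      exact hwb ⟨q, S.f x a w, hd, by simpa using hδ, (not_le.1 hlt).le⟩
  have hcell : ∀ c ∈ E.C, |∑ q : E.reps, θ c q * S.PW.real c * g q -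
      ∫ w in c, g (S.f x a w) ∂S.PW| ≤ ∫ w in c, (ε / 2 + bad.indicator 1 w) ∂S.PW := by
    intro c hcC
    have hθc := hθ c hcC
    have h1 : ∑ q : E.reps, θ c q * S.PW.real c * g q - ∫ w in c, g (S.f x a w) ∂S.PW =
        ∫ w in c, (∑ q : E.reps, θ c q * g q - g (S.f x a w)) ∂S.PW := by
      rw [integral_sub (integrable_const _) hint.integrableOn, setIntegral_const, smul_eq_mul,
        Finset.mul_sum]
      congr 1
      exact Finset.sum_congr rfl fun q _ => by ring
    rw [h1]
    refine (abs_integral_le_integral_abs).trans ?_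
    refine setIntegral_mono_on ((integrable_const _).sub hint.integrableOn).abs
      hbound.integrableOn (E.measurableSet_C c hcC) fun w hw => ?_
    have h2 : ∑ q : E.reps, θ c q * g q - g (S.f x a w) =
        ∑ q : E.reps, θ c q * (g q - g (S.f x a w)) := by
      simp only [mul_sub, Finset.sum_sub_distrib]
      rw [← Finset.sum_mul, hθc.1.2, one_mul]
    rw [h2]
    calc |∑ q : E.reps, θ c q * (g q - g (S.f x a w))|
        ≤ ∑ q : E.reps, |θ c q * (g q - g (S.f x a w))| := Finset.abs_sum_le_sum_abs _ _
      _ ≤ ∑ q : E.reps, θ c q * (ε / 2 + bad.indicator 1 w) := by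
          refine Finset.sum_le_sum fun q _ => ?_
          by_cases hq : q ∈ E.cluster (E.rho x) a c
          · rw [abs_mul, abs_of_nonneg (hθc.1.1 q)]
            exact mul_le_mul_of_nonneg_left (hclose c hcC w hw q hq) (hθc.1.1 q)
          · simp [hθc.2 q hq]
      _ = ε / 2 + bad.indicator 1 w := by rw [← Finset.sum_mul, hθc.1.2, one_mul]
  have hsum : ∑ q : E.reps, (∑ c ∈ E.C, θ c q * S.PW.real c) * g q =
      ∑ c ∈ E.C, ∑ q : E.reps, θ c q * S.PW.real c * g q := by
    simp only [Finset.sum_mul]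
    exact Finset.sum_comm
  calc |∑ q : E.reps, (∑ c ∈ E.C, θ c q * S.PW.real c) * g q - ∫ w, g (S.f x a w) ∂S.PW|
      ≤ ∑ c ∈ E.C, |∑ q : E.reps, θ c q * S.PW.real c * g q - ∫ w in c, g (S.f x a w) ∂S.PW| := by
        rw [hsum, E.integral_eq_sum_setIntegral hint, ← Finset.sum_sub_distrib]
        exact Finset.abs_sum_le_sum_abs _ _
    _ ≤ ∑ c ∈ E.C, ∫ w in c, (ε / 2 + bad.indicator 1 w) ∂S.PW := Finset.sum_le_sum hcell
    _ = ε / 2 + S.PW.real bad := by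
        rw [← E.integral_eq_sum_setIntegral hbound, integral_add (integrable_const _) hind,
          integral_const, probReal_univ, one_smul, integral_indicator_one hbad]
    _ ≤ ε := by
        have h := hosc x hx a
        rw [trans, map_measureReal_apply hm (isOpen_oscSet g δ (ε / 2)).measurableSet] at h
        change S.PW.real bad ≤ _ at h
        linarith

/-! ### Convergence of robust dynamic programming -/

/-- If `v` is uniformly above `V` up to `ε`, so are its expectations under a distribution. -/
theorem sum_mul_le_sum_mul_add {ι : Type} [Fintype ι] {γ v V : ι → ℝ} (hγ : γ ∈ stdSimplex ℝ ι)
    {ε : ℝ} (h : ∀ i, V i ≤ v i + ε) : ∑ i, γ i * V i ≤ ∑ i, γ i * v i + ε := by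
  calc ∑ i, γ i * V i ≤ ∑ i, γ i * (v i + ε) :=
        Finset.sum_le_sum fun i _ => mul_le_mul_of_nonneg_left (h i) (hγ.1 i)
    _ = ∑ i, γ i * v i + ε := by
        simp only [mul_add, Finset.sum_add_distrib]
        rw [← Finset.sum_mul, hγ.2, one_mul]

section
variable [Finite U] [Nonempty U] [Finite Z] {Lf : ℝ}

/-- The pessimistic and optimistic values approach the exact ones uniformly, by induction on the
horizon: the errors of the previous step and of the approximation of integrals add up. -/
theorem eventually_exactValue_approx (hlip : S.LipschitzDynamics Lf) (hdens : S.BoundedDensity)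
    (hsafe : S.CompactSafeNullBoundary) {D : ℝ → Discretization S}
    (hD : ∀ η > 0, (D η).SizeLE η) (k : ℕ) {ε : ℝ} (hε : 0 < ε) :
    ∀ᶠ η in 𝓝[>] 0, ∀ x z, exactValue S A k x z ≤ (smdp (D η)).vLow A k x z + ε ∧
      (smdp (D η)).vUp A k x z ≤ exactValue S A k x z + ε := by
  induction k generalizing ε with
  | zero =>
    refine Eventually.of_forall fun η x z => ⟨?_, ?_⟩
    · exact le_add_of_nonneg_right hε.le
    · exact le_add_of_nonneg_right hε.le
  | succ k ih =>
    have hV := isValue_exactValue A hlip k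
    have hint : ∀ z, ∀ᶠ η in 𝓝[>] 0, ∀ x ∈ S.safe, ∀ a, ∀ γ ∈ (smdp (D η)).Γ ((D η).rho x) a,
        |∑ s' : (smdp (D η)).reps, γ s' * exactValue S A k s' (A.step z (S.L s')) -
          ∫ w, exactValue S A k (S.f x a w) (A.step z (S.L (S.f x a w))) ∂S.PW| ≤ ε / 2 := fun z =>
      eventually_abs_sum_sub_integral_le hlip hdens hsafe hD
        (g := fun y => exactValue S A k y (A.step z (S.L y)))
        (measurable_stepValue A hV.measurable z) (fun y => hV.mem_Icc _ _)
        (fun y hy => continuousAt_stepValue A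
          (fun z x hx => continuousAt_exactValue A hlip hdens hsafe.lebesgue_boundarySet k z hx)
          z hy) (half_pos hε)
    filter_upwards [ih (half_pos hε), eventually_all.2 hint] with η hk hγ x z
    by_cases hx : x ∈ S.safe
    · have hM := smdp_wellFormed (D η)
      have hl := UMDP.isCellValue_vLow (A := A) hM k
      have hu := UMDP.isCellValue_vUp (A := A) hM k
      by_cases hz : z ∈ A.accept
      · rw [(isValue_exactValue A hlip (k + 1)).eq_one x hx z hz,
          (UMDP.isCellValue_vLow (A := A) hM (k + 1)).eq_one x hx z hz,
          (UMDP.isCellValue_vUp (A := A) hM (k + 1)).eq_one x hx z hz]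
        constructor <;> linarith
      · have hs : (D η).rho x ∈ (D η).reps := (D η).rho_mem x (Or.inl hx)
        rw [UMDP.vLow_succ_of_mem_safe hx, UMDP.vUp_succ_of_mem_safe hx,
          exactValue_succ A hx hz]
        constructor
        · refine ciSup_le fun a => ?_
          have hle := le_ciSup (Set.finite_range fun a =>
            (smdp (D η)).bellmanLow A a ((smdp (D η)).vLow A k) x z).bddAbove a
          refine le_trans ?_ (add_le_add_left hle ε)
          rw [UMDP.bellmanLow, if_neg hz, ← sub_le_iff_le_add]
          refine le_csInf ((hM _ hs a).1.image _) ?_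
          rintro _ ⟨γ, hγΓ, rfl⟩
          have h1 := abs_le.1 (hγ z x hx a γ hγΓ)
          have h2 := sum_mul_le_sum_mul_add ((hM _ hs a).2.2 hγΓ)
            fun s' : (smdp (D η)).reps => (hk s' (A.step z (S.L s'))).1
          rw [hl.expect_eq]
          linarith [h1.1]
        · refine ciSup_le fun a => ?_
          have hle := le_ciSup (Set.finite_range fun a => ∫ w, exactValue S A k (S.f x a w)
            (A.step z (S.L (S.f x a w))) ∂S.PW).bddAbove a
          refine le_trans ?_ (add_le_add_left hle ε)
          rw [UMDP.bellmanUp, if_neg hz]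
          refine csSup_le ((hM _ hs a).1.image _) ?_
          rintro _ ⟨γ, hγΓ, rfl⟩
          have h1 := abs_le.1 (hγ z x hx a γ hγΓ)
          have h2 := sum_mul_le_sum_mul_add ((hM _ hs a).2.2 hγΓ)
            fun s' : (smdp (D η)).reps => (hk s' (A.step z (S.L s'))).2
          rw [hu.expect_eq]
          linarith [h1.2]
    · have h1 : exactValue S A (k + 1) x z = 0 := if_neg hx
      have h2 : (smdp (D η)).vLow A (k + 1) x z = 0 := if_neg hx
      have h3 : (smdp (D η)).vUp A (k + 1) x z = 0 := if_neg hx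
      rw [h1, h2, h3]
      constructor <;> linarith

theorem eventually_pUp_sub_pLow_le (hlip : S.LipschitzDynamics Lf) (hdens : S.BoundedDensity)
    (hsafe : S.CompactSafeNullBoundary) {D : ℝ → Discretization S}
    (hD : ∀ η > 0, (D η).SizeLE η) (T : ℕ) {ε : ℝ} (hε : 0 < ε) :
    ∀ᶠ η in 𝓝[>] 0, ∀ x, (smdp (D η)).pUp A T x - (smdp (D η)).pLow A T x ≤ ε := by
  filter_upwards [eventually_exactValue_approx A hlip hdens hsafe hD T (half_pos hε)] with η h x
  have h1 := h x (A.step A.start (S.L x))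
  have h2 := h1.1
  have h3 := h1.2
  rw [UMDP.pUp, UMDP.pLow]
  linarith

end

theorem smdp_asymptoticallyOptimal [Finite U] [Nonempty U] [MeasurableSpace U]
    [DiscreteMeasurableSpace U] {Lf : ℝ} (hlip : S.LipschitzDynamics Lf) (hdens : S.BoundedDensity)
    (hsafe : S.CompactSafeNullBoundary) {D : ℝ → Discretization S}
    (hD : ∀ η > 0, (D η).SizeLE η) : AsymptoticallyOptimal fun η => smdp (D η) := by
  intro φ' T Z _ A hA σ hσ
  have key : ∀ ε > 0, ∀ᶠ η in 𝓝[>] (0 : ℝ), ∀ x,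
      |S.optProb x (S.spec φ') T - S.prob ((smdp (D η)).refine A (σ η)) x (S.spec φ') T| < ε ∧
      |S.optProb x (S.spec φ') T - (smdp (D η)).pLow A T x| < ε ∧
      |S.optProb x (S.spec φ') T - (smdp (D η)).pUp A T x| < ε := by
    intro ε hε
    filter_upwards [eventually_pUp_sub_pLow_le A hlip hdens hsafe hD T (half_pos hε),
      self_mem_nhdsWithin] with η hη hpos x
    have hM := smdp_wellFormed (D η)
    have hS := smdp_sound hlip (D η)
    have h1 := UMDP.pLow_le_prob hlip hM hS hA (hσ η hpos) x
    have h2 := UMDP.prob_refine_le_optProb (M := smdp (D η)) (A := A) hlip (σ η) (S.spec φ') T x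
    have h3 := UMDP.optProb_le_pUp hlip hM hS hA T x
    have h4 := hη x
    refine ⟨?_, ?_, ?_⟩ <;> rw [abs_lt] <;> constructor <;> linarith
  refine ⟨?_, ?_, ?_⟩ <;> rw [Metric.tendstoUniformly_iff] <;> intro ε hε
  · exact (key ε hε).mono fun η h x => (h x).1
  · exact (key ε hε).mono fun η h x => (h x).2.1
  · exact (key ε hε).mono fun η h x => (h x).2.2

end StochSystem

namespace StochSystem

variable {n d : ℕ} {U AP : Type} {S : StochSystem n d U AP}

/-! ### The refinement algorithm -/

section
variable {Z : Type} (abs : ℝ → UMDP S) (η : ℕ → ℝ) (A : DFA (Set AP) Z) (T : ℕ) (ε : ℝ)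
  (pick : ℕ → UMDP.Strategy U S Z)

/-- The data that the algorithm computes for the parameter `η i`. -/
def rdpResult (i : ℕ) : RDPResult S Z where
  umdp := abs (η i)
  lower := (abs (η i)).pLow A T
  upper := (abs (η i)).pUp A T
  strat := pick i

theorem algRun_succ (k : ℕ) : algRun abs η A T ε pick (k + 1) =
    algStep abs η A T ε pick (algRun abs η A T ε pick k) :=
  Function.iterate_succ_apply' _ _ _

/-- As long as no previous abstraction has a gap of at most `ε`, the algorithm goes on. -/
theorem algRun_succ_eq {k : ℕ}
    (h : ∀ i < k, ∃ x, ε < (abs (η (i + 1))).pUp A T x - (abs (η (i + 1))).pLow A T x) :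
    algRun abs η A T ε pick (k + 1) = ⟨k + 1, some (rdpResult abs η A T pick (k + 1))⟩ := by
  induction k with
  | zero =>
    rw [algRun_succ, algStep, if_pos]
    · rfl
    · intro r hr
      exact absurd hr (by simp [algRun])
  | succ k ih =>
    rw [algRun_succ, ih fun i hi => h i (by omega), algStep, if_pos]
    · rfl
    · intro r hr
      obtain rfl : rdpResult abs η A T pick (k + 1) = r := by simpa using hr
      exact h k (Nat.lt_succ_self k)

end

theorem smdp_algorithmSolvesInFiniteTime [Finite U] [Nonempty U] [MeasurableSpace U]
    [DiscreteMeasurableSpace U] {Lf : ℝ} (hlip : S.LipschitzDynamics Lf)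
    (hdens : S.BoundedDensity) (hsafe : S.CompactSafeNullBoundary) {D : ℝ → Discretization S}
    (hD : ∀ η > 0, (D η).SizeLE η) : AlgorithmSolvesInFiniteTime fun η => smdp (D η) := by
  intro φ' T ε hε
  refine ⟨(S.spec φ').exists_recognizedBy, fun Z _ A hA η hpos hanti hlim pick hpick => ?_⟩
  have hη : Tendsto (fun i => η (i + 1)) atTop (𝓝[>] 0) :=
    tendsto_nhdsWithin_iff.2 ⟨(tendsto_add_atTop_iff_nat 1).2 hlim,
      Eventually.of_forall fun i => hpos (i + 1)⟩
  have hex : ∃ i, ∀ x, (smdp (D (η (i + 1)))).pUp A T x - (smdp (D (η (i + 1)))).pLow A T x ≤ ε :=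
    (hη.eventually (eventually_pUp_sub_pLow_le A hlip hdens hsafe hD T hε)).exists
  have hgap := Nat.find_spec hex
  have hrun := algRun_succ_eq (fun η => smdp (D η)) η A T ε pick (k := Nat.find hex) fun i hi => by
    simpa only [not_forall, not_le] using Nat.find_min hex hi
  refine ⟨Nat.find hex + 1, _, ?_, by rw [hrun], ?_⟩
  · rw [hrun]
    intro hcont
    obtain ⟨x, hx⟩ := hcont _ rfl
    exact absurd (hgap x) (not_le.2 hx)
  · exact UMDP.solves_of_gap_le hlip (smdp_wellFormed _) (smdp_sound hlip _) hA (hpick _) hgap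

end StochSystem

end

theorem mainTheorem3 {n d : ℕ} {U AP : Type} [Finite U] [Nonempty U] [MeasurableSpace U]
    [DiscreteMeasurableSpace U] [Finite AP] (S : StochSystem n d U AP) (Lf : ℝ)
    (hsafe : S.CompactSafeNullBoundary) (hdens : S.BoundedDensity)
    (hlip : S.LipschitzDynamics Lf)
    (D : ℝ → StochSystem.Discretization S) (hD : ∀ η > 0, (D η).SizeLE η) :
    StochSystem.IsAbstractionProcedure (fun η => StochSystem.smdp (D η)) ∧
    (∀ η > 0, (StochSystem.smdp (D η)).ambiguityDiameter ≤ ENNReal.ofReal ((4 * Lf + 4) * η)) ∧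
    (∀ η > 0, (D η).Centered η →
      (StochSystem.smdp (D η)).ambiguityDiameter ≤ ENNReal.ofReal ((4 * Lf + 2) * η)) ∧
    Tendsto (fun η => (StochSystem.smdp (D η)).ambiguityDiameter) (𝓝[>] 0) (𝓝 0) ∧
    StochSystem.AsymptoticallyOptimal (fun η => StochSystem.smdp (D η)) ∧
    StochSystem.AlgorithmSolvesInFiniteTime (fun η => StochSystem.smdp (D η)) := by
  have hdiam : ∀ η > 0,
      (StochSystem.smdp (D η)).ambiguityDiameter ≤ ENNReal.ofReal ((4 * Lf + 4) * η) :=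
    fun η hη => StochSystem.ambiguityDiameter_smdp_le_of_sizeLE hlip (hD η hη)
  refine ⟨fun η hη => ⟨hD η hη, StochSystem.smdp_wellFormed _, StochSystem.smdp_sound hlip _⟩,
    hdiam, fun η hη hc => StochSystem.ambiguityDiameter_smdp_le_of_centered hlip (hD η hη) hc, ?_,
    StochSystem.smdp_asymptoticallyOptimal hlip hdens hsafe hD,
    StochSystem.smdp_algorithmSolvesInFiniteTime hlip hdens hsafe hD⟩
  have hlim : Tendsto (fun η : ℝ => ENNReal.ofReal ((4 * Lf + 4) * η)) (𝓝[>] 0) (𝓝 0) := by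
    have h : Continuous fun η : ℝ => ENNReal.ofReal ((4 * Lf + 4) * η) :=
      ENNReal.continuous_ofReal.comp (by fun_prop)
    simpa using (h.tendsto 0).mono_left nhdsWithin_le_nhds
  exact tendsto_of_tendsto_of_tendsto_of_le_of_le' tendsto_const_nhds hlim
    (Eventually.of_forall fun _ => zero_le) (eventually_nhdsWithin_of_forall hdiam)
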